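/- **Proposition (Klein arrangement).** Conventions: an arrangement of lines $\mathcal{A}\subset\mathbb{P}^2_{\mathbb{C}}$ is supersolvable if its intersection lattice has a maximal chain of modular elements. A supersolvable resolution of $\mathcal{A}$ of length $k$ is a chain of arrangements $\mathcal{A}=Y_0\subseteq Y_1\subseteq\dots\subseteq Y_k$ with $|Y_i|=|\mathcal{A}|+i$ and $Y_k$ supersolvable, and $\mathrm{ext\,SS}(\mathcal{A})$ is the least length of such a resolution. $\mathcal{A}$ is free with exponents $(d_2,d_3)$ if the module of derivations $\theta$ of $S=\mathbb{C}[x,y,z]$ with $\theta(\alpha_\ell)\in\langle\alpha_\ell\rangle$ for every line $\ell=\ker\alpha_\ell$ of $\mathcal{A}$ is a free $S$-module with a homogeneous basis of polynomial degrees $1,d_2,d_3$. Let $a=(-1+\sqrt{-7})/2$, and let $\mathcal{K}$ be the Klein arrangement, given by the linear forms $x,\ y,\ z,\ x\pm y,\ x\pm z,\ y\pm z,\ x\pm y\pm az,\ x\pm ay\pm z,\ ax\pm y\pm z$. Then $\mathcal{K}$ has $21$ lines, $t_3=28$ triple points, $t_4=21$ quadruple points and no other singular points, and $$\mathrm{ext\,SS}(\mathcal{K})\le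 20 .$$ Moreover, for every quadruple point $O$ of $\mathcal{K}$ the following hold. 1. Exactly $20$ singular points of $\mathcal{K}$ lie on none of the four lines of $\mathcal{K}$ through $O$. The lines joining $O$ with these $20$ points are $12$ in number. Adding them to $\mathcal{K}$ gives an arrangement of $33$ lines which is supersolvable and free with exponents $(15,17)$. 2. There are arrangements of $41$ lines obtained from $\mathcal{K}$ by adding $20$ lines through $O$ that include all these $12$ joining lines. Every such arrangement is the last term of a supersolvable resolution of $\mathcal{K}$ of length $20$; it is supersolvable and free with exponents $(17,23)$. -/

import Mathlib

/-- An arrangement of hyperplanes in the projective space `ℙ(V)`: a finite set of linear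
hyperplanes of `V`, i.e. of kernels of nonzero linear forms. For `V = Fin 3 → ℂ` this is an
arrangement of lines in the complex projective plane. -/
@[ext] structure HyperplaneArrangement (K V : Type*) [Field K] [AddCommGroup V] [Module K V] where
  hyperplanes : Set (Submodule K V)
  finite : hyperplanes.Finite
  isHyperplane : ∀ H ∈ hyperplanes, ∃ f : Module.Dual K V, f ≠ 0 ∧ H = LinearMap.ker f

/-- `x` is a modular element of the lattice `L`: it forms a modular pair with every `y`. -/
def IsModularElement {L : Type*} [Lattice L] (x : L) : Prop :=
  ∀ y z : L, z ≤ y → z ⊔ (x ⊓ y) = (z ⊔ x) ⊓ y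

/-- Supersolvability of a (geometric) lattice: there is a maximal chain of modular elements. -/
def IsSupersolvableLattice (L : Type*) [Lattice L] : Prop :=
  ∃ c : Set L, IsMaxChain (· ≤ ·) c ∧ ∀ x ∈ c, IsModularElement x

namespace HyperplaneArrangement

section General

variable {K V : Type*} [Field K] [AddCommGroup V] [Module K V] (A : HyperplaneArrangement K V)

/-- The number of hyperplanes `|A|`. -/
noncomputable def card : ℕ := A.hyperplanes.ncard

/-- All intersections of hyperplanes of `A`, the empty intersection being `V`. -/
def flats : Set (Submodule K V) := {X | ∃ s ⊆ A.hyperplanes, X = sInf s}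

theorem sInf_mem_flats {S : Set (Submodule K V)} (hS : S ⊆ A.flats) : sInf S ∈ A.flats := by
  refine ⟨{H | H ∈ A.hyperplanes ∧ ∃ X ∈ S, X ≤ H}, fun H hH => hH.1, le_antisymm ?_ ?_⟩
  · exact le_sInf fun H ⟨_, X, hX, hXH⟩ => (sInf_le hX).trans hXH
  · refine le_sInf fun X hX => ?_
    obtain ⟨s, hs, rfl⟩ := hS hX
    exact le_sInf fun H hH => sInf_le ⟨hs hH, sInf s, hX, sInf_le hH⟩

theorem inf_mem_flats {X Y : Submodule K V} (hX : X ∈ A.flats) (hY : Y ∈ A.flats) :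
    X ⊓ Y ∈ A.flats := by
  rw [← sInf_pair]
  exact A.sInf_mem_flats (by rintro Z (rfl | rfl) <;> assumption)

/-- Flats ordered by inclusion. The infimum is the intersection, and the supremum of `X` and `Y` is
the intersection of all flats containing both. -/
instance : Lattice A.flats where
  inf X Y := ⟨X.1 ⊓ Y.1, A.inf_mem_flats X.2 Y.2⟩
  inf_le_left X Y := show X.1 ⊓ Y.1 ≤ X.1 from inf_le_left
  inf_le_right X Y := show X.1 ⊓ Y.1 ≤ Y.1 from inf_le_right
  le_inf X Y Z h h' := show X.1 ≤ Y.1 ⊓ Z.1 from le_inf h h'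
  sup X Y := ⟨sInf {Z | Z ∈ A.flats ∧ X.1 ≤ Z ∧ Y.1 ≤ Z}, A.sInf_mem_flats fun _ h => h.1⟩
  le_sup_left X Y := show X.1 ≤ sInf {Z | Z ∈ A.flats ∧ X.1 ≤ Z ∧ Y.1 ≤ Z} from
    le_sInf fun _ h => h.2.1
  le_sup_right X Y := show Y.1 ≤ sInf {Z | Z ∈ A.flats ∧ X.1 ≤ Z ∧ Y.1 ≤ Z} from
    le_sInf fun _ h => h.2.2
  sup_le X Y Z h h' := show sInf {W | W ∈ A.flats ∧ X.1 ≤ W ∧ Y.1 ≤ W} ≤ Z.1 from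
    sInf_le ⟨Z.2, h, h'⟩

/-- The intersection lattice `L(A)`: flats ordered by reverse inclusion. -/
abbrev IntersectionLattice : Type _ := (A.flats)ᵒᵈ

/-- `A` is supersolvable if its intersection lattice is. -/
def IsSupersolvable : Prop := IsSupersolvableLattice A.IntersectionLattice

/-- `Y` is a supersolvable resolution of `A` of length `k`: a sequence
`A = Y₀ ⊆ Y₁ ⊆ ... ⊆ Y_k` with `|Y_i| = |A| + i` and `Y_k` supersolvable. -/
structure IsSupersolvableResolution (k : ℕ) (Y : Fin (k + 1) → HyperplaneArrangement K V) :
    Prop where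
  zero : Y 0 = A
  mono : ∀ i j, i ≤ j → (Y i).hyperplanes ⊆ (Y j).hyperplanes
  card : ∀ i, (Y i).card = A.card + i
  supersolvable : (Y (Fin.last k)).IsSupersolvable

/-- The extension to supersolvability number: the least length of a supersolvable resolution
(`⊤` if there is none). -/
noncomputable def extSS : ℕ∞ :=
  ⨅ (k : ℕ) (_ : ∃ Y, A.IsSupersolvableResolution k Y), (k : ℕ∞)

/-- The number of hyperplanes of `A` through a point of the projective space. -/
noncomputable def multiplicity (P : Projectivization K V) : ℕ :=
  {H | H ∈ A.hyperplanes ∧ P.submodule ≤ H}.ncard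

/-- For a line arrangement: the number `t_r` of `r`-fold points (`r ≥ 2`). -/
noncomputable def t (r : ℕ) : ℕ := {P | A.multiplicity P = r}.ncard

/-- For a line arrangement: the singular points not on any line of `A` through `O`. -/
def singOff (O : Projectivization K V) : Set (Projectivization K V) :=
  {P | 2 ≤ A.multiplicity P ∧ ∀ H ∈ A.hyperplanes, O.submodule ≤ H → ¬ P.submodule ≤ H}

/-- The lines joining `O` with the singular points not on any line of `A` through `O`. -/
def joins (O : Projectivization K V) : Set (Submodule K V) :=
  {H | ∃ P ∈ A.singOff O, H = O.submodule ⊔ P.submodule}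

end General

section Derivations

variable {K σ : Type*} [Field K] [Fintype σ] [DecidableEq σ]

/-- A linear form on `K^σ` as a polynomial. -/
noncomputable def linearPoly (f : Module.Dual K (σ → K)) : MvPolynomial σ K :=
  ∑ i, MvPolynomial.C (f (Pi.single i 1)) * MvPolynomial.X i

/-- The module `D(A)` of `A`-derivations: derivations `θ` of the polynomial ring with
`θ(α) ∈ ⟨α⟩` for the linear form `α` of every hyperplane of `A`. -/
def derivationModule (A : HyperplaneArrangement K (σ → K)) :
    Submodule (MvPolynomial σ K) (Derivation K (MvPolynomial σ K) (MvPolynomial σ K)) where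
  carrier := {θ | ∀ f : Module.Dual K (σ → K), LinearMap.ker f ∈ A.hyperplanes →
    θ (linearPoly f) ∈ Ideal.span {linearPoly f}}
  add_mem' h h' f hf := Ideal.add_mem _ (h f hf) (h' f hf)
  zero_mem' _ _ := Ideal.zero_mem _
  smul_mem' c _ h f hf := Ideal.mul_mem_left _ c (h f hf)

/-- `A` is free with exponents `d`: the module `D(A)` has a basis of homogeneous derivations whose
(polynomial) degrees are the `d i`. -/
def IsFreeWithExponents (A : HyperplaneArrangement K (σ → K)) {r : ℕ} (d : Fin r → ℕ) : Prop :=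
  ∃ b : Module.Basis (Fin r) (MvPolynomial σ K) A.derivationModule,
    ∀ i j, ((b i).1 (MvPolynomial.X j)).IsHomogeneous (d i)

end Derivations

end HyperplaneArrangement

/-- The number `a = (-1 + √-7) / 2`, a root of `a² + a + 2 = 0`. -/
noncomputable def kleinA : ℂ := (-1 + (Real.sqrt 7 : ℂ) * Complex.I) / 2

/-- The coefficient vectors of the linear forms
`x, y, z, x ± y, x ± z, y ± z, x ± y ± a z, x ± a y ± z, a x ± y ± z`. -/
noncomputable def kleinForm : Fin 21 → Fin 3 → ℂ :=
  ![![1, 0, 0], ![0, 1, 0], ![0, 0, 1],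
    ![1, 1, 0], ![1, -1, 0], ![1, 0, 1], ![1, 0, -1], ![0, 1, 1], ![0, 1, -1],
    ![1, 1, kleinA], ![1, 1, -kleinA], ![1, -1, kleinA], ![1, -1, -kleinA],
    ![1, kleinA, 1], ![1, kleinA, -1], ![1, -kleinA, 1], ![1, -kleinA, -1],
    ![kleinA, 1, 1], ![kleinA, 1, -1], ![kleinA, -1, 1], ![kleinA, -1, -1]]

theorem kleinForm_ne_zero (i : Fin 21) : kleinForm i ≠ 0 := by
  intro h
  have h0 := congrFun h 0
  have h1 := congrFun h 1
  have h2 := congrFun h 2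
  fin_cases i <;> simp [kleinForm] at h0 h1 h2

/-- The linear form on `ℂ³` with coefficient vector `v`. -/
noncomputable def dotForm (v : Fin 3 → ℂ) : Module.Dual ℂ (Fin 3 → ℂ) :=
  ∑ i, v i • LinearMap.proj i

theorem dotForm_ne_zero {v : Fin 3 → ℂ} (hv : v ≠ 0) : dotForm v ≠ 0 := by
  intro h
  refine hv (funext fun i => ?_)
  have := LinearMap.congr_fun h (Pi.single i 1)
  simpa [dotForm, LinearMap.sum_apply, Pi.single_apply] using this

/-- The Klein arrangement of 21 lines in the complex projective plane: the mirrors of the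
reflections (all of order two) of the unitary reflection group of order 336, which is `±1` times
Klein's simple group of order 168. The coordinates are those in which the invariant quartic is
`x⁴ + y⁴ + z⁴ + 3 b (x²y² + y²z² + z²x²)`, where `b` is the complex conjugate of `a`. -/
noncomputable def kleinArrangement : HyperplaneArrangement ℂ (Fin 3 → ℂ) where
  hyperplanes := Set.range fun i => LinearMap.ker (dotForm (kleinForm i))
  finite := Set.finite_range _
  isHyperplane := by
    rintro _ ⟨i, rfl⟩
    exact ⟨_, dotForm_ne_zero (kleinForm_ne_zero i), rfl⟩

/-! Let `O` be a quadruple point. Two Klein lines off `O` meet in a singular point `P`; either `P`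
lies on one of the four Klein lines through `O`, or the line `OP` is one of the joins. So once the
joins are added, `O` is a modular point: the intersection of any two lines off `O` lies on a line of
the arrangement through `O`. Further lines through `O` do not disturb this.

A modular point gives both conclusions. For supersolvability, the sum of `O` with any flat is again
a flat, so `⊥ < O < L₀ < ⊤`, with `L₀` a line through `O`, is a maximal chain of modular elements.
For freeness, with `m + 1` lines through `O` and `n` off it, the exponents are `(1, m, n)`: a basis
consists of the Euler derivation, a derivation of degree `m` adapted to the pencil at `O` and
corrected along `O`, and the derivative along `O` times the product of the `n` forms off `O`;
Saito's criterion applies.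

Always `n = 21 - 4 = 17`, so 33 lines give `m = 15` and 41 lines give `m = 23`. The counts 20 and 12
are finite computations over `ℤ[a]`. The 12 joins already suffice for supersolvability; the other 8
lines of a resolution of length 20 are arbitrary members of the pencil at `O`. -/

namespace HyperplaneArrangement

/-! ### Linear forms in the polynomial ring: divisibility and correction of derivations -/

section LinearPoly

variable {K σ : Type*} [Field K] [Fintype σ] [DecidableEq σ]

theorem linearPoly_smul (c : K) (f : Module.Dual K (σ → K)) :
    linearPoly (c • f) = MvPolynomial.C c * linearPoly f := by
  simp [linearPoly, Finset.mul_sum, mul_assoc]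

theorem linearPoly_sub (f h : Module.Dual K (σ → K)) :
    linearPoly (f - h) = linearPoly f - linearPoly h := by
  simp [linearPoly, sub_mul, Finset.sum_sub_distrib]

theorem isHomogeneous_linearPoly (f : Module.Dual K (σ → K)) : (linearPoly f).IsHomogeneous 1 :=
  MvPolynomial.IsHomogeneous.sum _ _ _ fun _ _ => MvPolynomial.isHomogeneous_C_mul_X _ _

theorem sum_apply_single_mul (f : Module.Dual K (σ → K)) (x : σ → K) :
    ∑ i, f (Pi.single i 1) * x i = f x := by
  conv_rhs => rw [pi_eq_sum_univ' x, map_sum]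
  refine Finset.sum_congr rfl fun i _ => ?_
  rw [map_smul, smul_eq_mul, mul_comm]

theorem eval_linearPoly (f : Module.Dual K (σ → K)) (x : σ → K) :
    MvPolynomial.eval x (linearPoly f) = f x := by
  simp [linearPoly, sum_apply_single_mul]

theorem derivation_linearPoly (θ : Derivation K (MvPolynomial σ K) (MvPolynomial σ K))
    (f : Module.Dual K (σ → K)) :
    θ (linearPoly f) = ∑ i, MvPolynomial.C (f (Pi.single i 1)) * θ (MvPolynomial.X i) := by
  simp [linearPoly]

theorem linearPoly_ne_zero {f : Module.Dual K (σ → K)} (hf : f ≠ 0) : linearPoly f ≠ 0 := by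
  intro h
  refine hf (LinearMap.ext fun x => ?_)
  rw [← eval_linearPoly, h, map_zero, LinearMap.zero_apply]

/-- The substitution `x ↦ x - f(x) p`, the projection along `p` onto `ker f` when `f p = 1`. -/
noncomputable def projAlong (f : Module.Dual K (σ → K)) (p : σ → K) :
    MvPolynomial σ K →ₐ[K] MvPolynomial σ K :=
  MvPolynomial.aeval fun i => MvPolynomial.X i - MvPolynomial.C (p i) * linearPoly f

theorem projAlong_linearPoly (f h : Module.Dual K (σ → K)) (p : σ → K) :
    projAlong f p (linearPoly h) = linearPoly h - MvPolynomial.C (h p) * linearPoly f := by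
  rw [← sum_apply_single_mul h p]
  conv_lhs => rw [linearPoly]
  conv_rhs => rw [linearPoly]
  simp only [map_sum, map_mul, projAlong, MvPolynomial.aeval_X, MvPolynomial.algHom_C,
    MvPolynomial.algebraMap_eq, mul_sub, Finset.sum_sub_distrib, Finset.sum_mul, mul_assoc]

theorem linearPoly_dvd_sub_projAlong (f : Module.Dual K (σ → K)) (p : σ → K)
    (q : MvPolynomial σ K) : linearPoly f ∣ q - projAlong f p q := by
  induction q using MvPolynomial.induction_on with
  | C a => simp [projAlong]
  | add q r hq hr =>
    rw [map_add, add_sub_add_comm]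
    exact dvd_add hq hr
  | mul_X q i hq =>
    have : q * MvPolynomial.X i - projAlong f p (q * MvPolynomial.X i) =
        (q - projAlong f p q) * MvPolynomial.X i
          + projAlong f p q * MvPolynomial.C (p i) * linearPoly f := by
      simp only [map_mul, projAlong, MvPolynomial.aeval_X]
      ring
    rw [this]
    exact dvd_add (hq.mul_right _) (dvd_mul_left _ _)

/-- Modulo `f` the substitution is the identity, and it kills `f`. Divisibility by `f` thus becomes
vanishing under a ring homomorphism into a domain, which also yields primality. -/
theorem linearPoly_dvd_iff {f : Module.Dual K (σ → K)} {p : σ → K} (hp : f p = 1)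
    {q : MvPolynomial σ K} : linearPoly f ∣ q ↔ projAlong f p q = 0 := by
  constructor
  · rintro ⟨r, rfl⟩
    rw [map_mul, projAlong_linearPoly, hp]
    simp
  · intro h
    simpa [h] using linearPoly_dvd_sub_projAlong f p q

theorem exists_apply_eq_one {V : Type*} [AddCommGroup V] [Module K V] {f : Module.Dual K V}
    (hf : f ≠ 0) : ∃ p, f p = 1 := by
  obtain ⟨x, hx⟩ : ∃ x, f x ≠ 0 := by
    by_contra! h
    exact hf (LinearMap.ext h)
  exact ⟨(f x)⁻¹ • x, by simp [hx]⟩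

theorem prime_linearPoly {f : Module.Dual K (σ → K)} (hf : f ≠ 0) : Prime (linearPoly f) := by
  obtain ⟨p, hp⟩ := exists_apply_eq_one hf
  refine ⟨linearPoly_ne_zero hf, fun h => ?_, fun a b h => ?_⟩
  · rw [isUnit_iff_dvd_one, linearPoly_dvd_iff hp] at h
    simp at h
  · rw [linearPoly_dvd_iff hp, map_mul] at h
    rwa [linearPoly_dvd_iff hp, linearPoly_dvd_iff hp, ← mul_eq_zero]

theorem exists_smul_eq_of_ker_le {V : Type*} [AddCommGroup V] [Module K V]
    {f h : Module.Dual K V} (hh : h ≠ 0)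
    (hle : LinearMap.ker f ≤ LinearMap.ker h) : ∃ c : K, c ≠ 0 ∧ h = c • f := by
  have := mem_span_of_iInf_ker_le_ker (ι := Unit) (L := fun _ => f) (K := h) (by simpa using hle)
  rw [Set.range_const, Submodule.mem_span_singleton] at this
  obtain ⟨c, rfl⟩ := this
  exact ⟨c, fun hc => hh (by simp [hc]), rfl⟩

theorem isRelPrime_linearPoly {f h : Module.Dual K (σ → K)} (hf : f ≠ 0) (hh : h ≠ 0)
    (hne : LinearMap.ker f ≠ LinearMap.ker h) : IsRelPrime (linearPoly f) (linearPoly h) := by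
  rw [(prime_linearPoly hf).irreducible.isRelPrime_iff_not_dvd]
  rintro ⟨r, hr⟩
  obtain ⟨c, hc, rfl⟩ := exists_smul_eq_of_ker_le (f := f) hh fun x hx => by
    rw [LinearMap.mem_ker] at hx ⊢
    rw [← eval_linearPoly, hr, map_mul, eval_linearPoly, hx, zero_mul]
  exact hne (LinearMap.ker_smul f c hc).symm

theorem prod_linearPoly_dvd {ι : Type*} {s : Finset ι} {ψ : ι → Module.Dual K (σ → K)}
    (h0 : ∀ i ∈ s, ψ i ≠ 0)
    (hne : ∀ i ∈ s, ∀ j ∈ s, i ≠ j → LinearMap.ker (ψ i) ≠ LinearMap.ker (ψ j))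
    {q : MvPolynomial σ K} (h : ∀ i ∈ s, linearPoly (ψ i) ∣ q) :
    ∏ i ∈ s, linearPoly (ψ i) ∣ q :=
  Finset.prod_dvd_of_isRelPrime
    (fun i hi j hj hij => isRelPrime_linearPoly (h0 i hi) (h0 j hj) (hne i hi j hj hij)) h

/-- The ideal generated by a linear form is homogeneous. This later allows the correction term to be
replaced by its component of the right degree. -/
theorem linearPoly_dvd_homogeneousComponent (f : Module.Dual K (σ → K)) {q : MvPolynomial σ K}
    (h : linearPoly f ∣ q) (n : ℕ) : linearPoly f ∣ MvPolynomial.homogeneousComponent n q := by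
  rw [← Ideal.mem_span_singleton] at h ⊢
  let _ : GradedRing (MvPolynomial.homogeneousSubmodule σ K) := MvPolynomial.gradedAlgebra
  refine MvPolynomial.homogeneousComponent_mem_of_mem (Ideal.homogeneous_span _ _ ?_) h n
  rintro _ rfl
  exact ⟨1, isHomogeneous_linearPoly f⟩

/-- Derivations that act compatibly on a family of linear forms not vanishing at `p` can be
corrected by a multiple of the derivative along `p`. -/
theorem exists_forall_linearPoly_dvd_sub {ι : Type*} (s : Finset ι)
    (ψ : ι → Module.Dual K (σ → K)) (p : σ → K) (hp : ∀ i ∈ s, ψ i p = 1)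
    (hinj : Set.InjOn ψ s) (θ : Derivation K (MvPolynomial σ K) (MvPolynomial σ K))
    (hθ : ∀ i ∈ s, ∀ j ∈ s, i ≠ j → linearPoly (ψ i - ψ j) ∣ θ (linearPoly (ψ i - ψ j))) :
    ∃ g, ∀ i ∈ s, linearPoly (ψ i) ∣ θ (linearPoly (ψ i)) - g := by
  classical
  induction s using Finset.induction_on with
  | empty => exact ⟨0, by simp⟩
  | insert k s hk ih =>
    obtain ⟨g, hg⟩ := ih (fun i hi => hp i (Finset.mem_insert_of_mem hi))
      (hinj.mono (by simp)) fun i hi j hj => hθ i (Finset.mem_insert_of_mem hi) j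
        (Finset.mem_insert_of_mem hj)
    have hpk := hp k (Finset.mem_insert_self _ _)
    have hp' : ∀ i ∈ s, ψ i p = 1 := fun i hi => hp i (Finset.mem_insert_of_mem hi)
    have hdiff : ∀ i ∈ s, ψ i - ψ k ≠ 0 := fun i hi h => hk <| by
      rw [← hinj (Finset.mem_insert_of_mem hi) (Finset.mem_insert_self _ _) (sub_eq_zero.1 h)]
      exact hi
    have hproj : ∀ i ∈ s, projAlong (ψ k) p (linearPoly (ψ i)) = linearPoly (ψ i - ψ k) := by
      intro i hi
      rw [projAlong_linearPoly, hp' i hi, linearPoly_sub, map_one, one_mul]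
    have hproj' : ∀ i ∈ s,
        projAlong (ψ k) p (linearPoly (ψ i - ψ k)) = linearPoly (ψ i - ψ k) := by
      intro i hi
      simp [projAlong_linearPoly, hp' i hi, hpk]
    have hself : projAlong (ψ k) p (linearPoly (ψ k)) = 0 := (linearPoly_dvd_iff hpk).1 dvd_rfl
    have hidem : ∀ q, projAlong (ψ k) p (projAlong (ψ k) p q) = projAlong (ψ k) p q := by
      intro q
      have := (linearPoly_dvd_iff hpk).1 (linearPoly_dvd_sub_projAlong (ψ k) p q)
      rw [map_sub, sub_eq_zero] at this
      exact this.symm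
    set F := θ (linearPoly (ψ k)) - g with hF
    -- On `ψ k = 0` each `ψ i` becomes `ψ i - ψ k`, so this divisibility is exactly what is needed
    -- to correct `g` by a multiple of `∏ ψ i`. The factors need not be coprime: they are grouped by
    -- kernel, that is, by the line joining `p` to the point where `ψ i` meets `ψ k`.
    have key : ∏ i ∈ s, linearPoly (ψ i - ψ k) ∣ projAlong (ψ k) p F := by
      rw [← Finset.prod_fiberwise_of_maps_to (t := s.image fun i => LinearMap.ker (ψ i - ψ k))
        (g := fun i => LinearMap.ker (ψ i - ψ k)) (fun i hi => Finset.mem_image_of_mem _ hi)]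
      refine Finset.prod_dvd_of_isRelPrime ?_ ?_
      · intro N _ N' _ hN
        refine IsRelPrime.prod_left fun i hi => IsRelPrime.prod_right fun j hj => ?_
        rw [Finset.mem_filter] at hi hj
        refine isRelPrime_linearPoly (hdiff i hi.1) (hdiff j hj.1) ?_
        rwa [hi.2, hj.2]
      · intro N hN
        obtain ⟨i₀, hi₀, rfl⟩ := Finset.mem_image.1 hN
        obtain ⟨u, hu⟩ := hθ i₀ (Finset.mem_insert_of_mem hi₀) k (Finset.mem_insert_self _ _)
          (fun h => hk (h ▸ hi₀))
        -- Within one group the differences are proportional, so a single quotient `u` serves them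
        -- all. The forms `ψ i` themselves remain coprime, so the full product divides before
        -- restriction to `ψ k = 0`.
        have hdvd : ∏ i ∈ s with LinearMap.ker (ψ i - ψ k) = LinearMap.ker (ψ i₀ - ψ k),
            linearPoly (ψ i) ∣ F - linearPoly (ψ k) * u := by
          refine prod_linearPoly_dvd ?_ ?_ ?_
          · intro i hi h
            have := hp' i (Finset.mem_filter.1 hi).1
            simp [h] at this
          · intro i hi j hj hij h
            have hi := (Finset.mem_filter.1 hi).1
            have hj := (Finset.mem_filter.1 hj).1
            have h0 : ψ j ≠ 0 := fun h0 => by simpa [h0] using hp' j hj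
            obtain ⟨c, -, hc⟩ := exists_smul_eq_of_ker_le h0 h.le
            have h1 := hp' j hj
            rw [hc, LinearMap.smul_apply, hp' i hi, smul_eq_mul, mul_one] at h1
            rw [h1, one_smul] at hc
            exact hij (hinj (Finset.mem_insert_of_mem hi) (Finset.mem_insert_of_mem hj) hc.symm)
          · intro i hi
            rw [Finset.mem_filter] at hi
            obtain ⟨c, -, hc⟩ := exists_smul_eq_of_ker_le (hdiff i hi.1) hi.2.ge
            have h1 : θ (linearPoly (ψ i)) - θ (linearPoly (ψ k)) =
                (linearPoly (ψ i) - linearPoly (ψ k)) * u := by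
              rw [← map_sub, ← linearPoly_sub, hc, linearPoly_smul, ← MvPolynomial.smul_eq_C_mul,
                Derivation.map_smul, hu, smul_mul_assoc]
            have h2 : F - linearPoly (ψ k) * u =
                (θ (linearPoly (ψ i)) - g) - linearPoly (ψ i) * u := by
              rw [hF]; linear_combination -h1
            rw [h2]
            exact dvd_sub (hg i hi.1) (dvd_mul_right _ _)
        have := map_dvd (projAlong (ψ k) p) hdvd
        rw [map_prod, map_sub, map_mul, hself, zero_mul, sub_zero] at this
        rwa [Finset.prod_congr rfl fun i hi => hproj i (Finset.mem_filter.1 hi).1] at this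
    obtain ⟨c, hc⟩ := key
    -- The added term is divisible by each earlier `ψ i`, so it affects only the condition at `k`.
    refine ⟨g + c * ∏ i ∈ s, linearPoly (ψ i), fun i hi => ?_⟩
    rw [← sub_sub]
    rcases Finset.mem_insert.1 hi with rfl | hi
    · rw [linearPoly_dvd_iff hpk, map_sub, map_mul, ← hF, map_prod, Finset.prod_congr rfl hproj,
        ← hidem, hc, map_mul, map_prod, Finset.prod_congr rfl hproj']
      ring
    · exact dvd_sub (hg i hi) ((Finset.dvd_prod_of_mem (fun i => linearPoly (ψ i)) hi).mul_left _)

end LinearPoly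

/-! ### Saito's criterion -/

section Saito

-- The matrix sends the coefficient vector of `f` to the vector of the `θ i (f)`, which is zero
-- modulo `f`. Multiplying by the adjugate shows that `f` divides the determinant times a nonzero
-- constant.
open MvPolynomial in
theorem linearPoly_dvd_det {K : Type*} [Field K] {r : ℕ} {f : Module.Dual K (Fin r → K)}
    (hf : f ≠ 0) (θ : Fin r → Derivation K (MvPolynomial (Fin r) K) (MvPolynomial (Fin r) K))
    (h : ∀ i, linearPoly f ∣ θ i (linearPoly f)) :
    linearPoly f ∣ (Matrix.of fun i j => θ i (X j)).det := by
  set M : Matrix (Fin r) (Fin r) (MvPolynomial (Fin r) K) := Matrix.of fun i j => θ i (X j)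
  obtain ⟨j, hj⟩ : ∃ j, f (Pi.single j 1) ≠ 0 := by
    by_contra! h0
    refine hf (LinearMap.ext fun x => ?_)
    rw [← sum_apply_single_mul]
    simp [h0]
  have h1 : M.adjugate.mulVec (M.mulVec fun j => C (f (Pi.single j 1))) =
      M.det • fun j => C (f (Pi.single j 1)) := by
    rw [Matrix.mulVec_mulVec, Matrix.adjugate_mul, Matrix.smul_mulVec, Matrix.one_mulVec]
  have h2 : linearPoly f ∣ M.det * C (f (Pi.single j 1)) := by
    have := congrFun h1 j
    rw [Pi.smul_apply, smul_eq_mul] at this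
    rw [← this]
    rw [Matrix.mulVec, dotProduct]
    refine Finset.dvd_sum fun i _ => dvd_mul_of_dvd_right ?_ (M.adjugate j i)
    convert h i using 1
    rw [derivation_linearPoly, Matrix.mulVec, dotProduct]
    exact Finset.sum_congr rfl fun j _ => mul_comm _ _
  refine ((prime_linearPoly hf).dvd_or_dvd h2).resolve_right fun h3 => ?_
  exact (prime_linearPoly hf).not_isUnit (isUnit_of_dvd_unit h3 ((Ne.isUnit hj).map C))

open MvPolynomial in
/-- Saito's criterion. -/
theorem exists_basis_derivationModule {K : Type*} [Field K] {r : ℕ}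
    (A : HyperplaneArrangement K (Fin r → K))
    (φ : Submodule K (Fin r → K) → Module.Dual K (Fin r → K))
    (hφ : ∀ H ∈ A.hyperplanes, φ H ≠ 0 ∧ H = LinearMap.ker (φ H))
    (b : Fin r → A.derivationModule)
    (hb : (Matrix.of fun i j => (b i).1 (X j)).det ∣
      ∏ H ∈ A.finite.toFinset, linearPoly (φ H)) :
    ∃ B : Module.Basis (Fin r) (MvPolynomial (Fin r) K) A.derivationModule, ⇑B = b := by
  let ev : A.derivationModule →ₗ[MvPolynomial (Fin r) K] Fin r → MvPolynomial (Fin r) K :=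
    { toFun := fun θ j => θ.1 (X j)
      map_add' := fun _ _ => rfl
      map_smul' := fun _ _ => rfl }
  set M : Matrix (Fin r) (Fin r) (MvPolynomial (Fin r) K) :=
    Matrix.of fun i j => (b i).1 (X j) with hM
  have hφ' : ∀ H ∈ A.finite.toFinset, φ H ≠ 0 ∧ H = LinearMap.ker (φ H) := fun H hH =>
    hφ H (A.finite.mem_toFinset.1 hH)
  -- The determinant of any `r` elements of the module is divisible by every defining form, hence by
  -- their product, hence by `M.det`.
  have hdvd : ∀ c : Fin r → A.derivationModule,
      M.det ∣ (Matrix.of fun i j => (c i).1 (X j)).det := by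
    intro c
    refine hb.trans (prod_linearPoly_dvd (fun H hH => (hφ' H hH).1) (fun H hH H' hH' hne => ?_)
      fun H hH => linearPoly_dvd_det (hφ' H hH).1 (fun i => (c i).1) fun i => ?_)
    · rwa [← (hφ' H hH).2, ← (hφ' H' hH').2]
    · rw [← Ideal.mem_span_singleton]
      refine (c i).2 _ ?_
      rw [← (hφ' H hH).2]
      exact A.finite.mem_toFinset.1 hH
  have hdet : M.det ≠ 0 := fun h => by
    rw [h, zero_dvd_iff, Finset.prod_eq_zero_iff] at hb
    obtain ⟨H, hH, h0⟩ := hb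
    exact linearPoly_ne_zero (hφ' H hH).1 h0
  have hli : LinearIndependent (MvPolynomial (Fin r) K) b := by
    exact LinearIndependent.of_comp ev (Matrix.linearIndependent_rows_of_det_ne_zero hdet)
  refine ⟨Module.Basis.mk hli fun θ _ => ?_, Module.Basis.coe_mk _ _⟩
  -- By Cramer's rule the numerators are determinants with one row replaced by `θ`; these again come
  -- from the module, so the coefficients of `θ` are polynomials.
  have hcr : ∀ i, M.det ∣ M.transpose.cramer (fun j => θ.1 (X j)) i := by
    intro i
    rw [Matrix.cramer_transpose_apply]
    convert hdvd (Function.update b i θ) using 2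
    ext k j
    by_cases hk : k = i
    · subst hk; simp
    · simp [hk, hM]
  choose e he using hcr
  suffices θ = ∑ i, e i • b i by
    rw [this]
    exact Submodule.sum_mem _ fun i _ => Submodule.smul_mem _ _ (Submodule.subset_span ⟨i, rfl⟩)
  refine Subtype.ext (MvPolynomial.derivation_ext fun j => mul_left_cancel₀ hdet ?_)
  have h1 := congrFun (Matrix.mulVec_cramer M.transpose fun j => θ.1 (X j)) j
  rw [Matrix.det_transpose, Pi.smul_apply, smul_eq_mul] at h1
  have h2 : (∑ i, e i • b i).1 (X j) = ∑ i, e i * (b i).1 (X j) := by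
    have := congrFun (map_sum ev (fun i => e i • b i) Finset.univ) j
    rwa [Finset.sum_apply] at this
  rw [← h1, funext he, h2, Finset.mul_sum, Matrix.mulVec, dotProduct]
  refine Finset.sum_congr rfl fun i _ => ?_
  rw [Matrix.transpose_apply, hM, Matrix.of_apply]
  ring

end Saito

end HyperplaneArrangement

namespace HyperplaneArrangement

/-! ### Freeness from a modular point -/

section ModularPoint

open MvPolynomial

variable {K : Type*} [Field K]

/-- The definition tests every form with a given kernel; these differ by nonzero scalars, so one
form per hyperplane suffices. -/
theorem mem_derivationModule_of_dvd {σ : Type*} [Fintype σ] [DecidableEq σ]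
    {A : HyperplaneArrangement K (σ → K)} {φ : Submodule K (σ → K) → Module.Dual K (σ → K)}
    (hφ : ∀ H ∈ A.hyperplanes, φ H ≠ 0 ∧ H = LinearMap.ker (φ H))
    {θ : Derivation K (MvPolynomial σ K) (MvPolynomial σ K)}
    (h : ∀ H ∈ A.hyperplanes, linearPoly (φ H) ∣ θ (linearPoly (φ H))) :
    θ ∈ A.derivationModule := by
  intro f hf
  obtain ⟨c, hc, hcf⟩ := exists_smul_eq_of_ker_le (f := f) (hφ _ hf).1 (hφ _ hf).2.le
  have := h _ hf
  rw [hcf, linearPoly_smul, ← smul_eq_C_mul, Derivation.map_smul, smul_eq_C_mul, smul_eq_C_mul,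
    ((hc.isUnit.map C).mul_left_dvd), ((hc.isUnit.map C).dvd_mul_left)] at this
  exact Ideal.mem_span_singleton.2 this

theorem mkDerivation_linearPoly {σ : Type*} [Fintype σ] [DecidableEq σ]
    (v : σ → MvPolynomial σ K) (f : Module.Dual K (σ → K)) :
    mkDerivation K v (linearPoly f) = ∑ i, C (f (Pi.single i 1)) * v i := by
  simp [derivation_linearPoly]

theorem sum_C_mul_pderiv_prod_eq_zero {σ ι : Type*} [Fintype σ] [DecidableEq σ] (s : Finset ι)
    (ψ : ι → Module.Dual K (σ → K)) (p : σ → K) (hp : ∀ i ∈ s, ψ i p = 0) :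
    ∑ j, C (p j) * pderiv j (∏ i ∈ s, linearPoly (ψ i)) = 0 := by
  classical
  have hpd : ∀ (j : σ) (f : Module.Dual K (σ → K)),
      pderiv j (linearPoly f) = C (f (Pi.single j 1)) := by
    intro j f
    rw [derivation_linearPoly]
    simp [pderiv_X, Pi.single_apply]
  induction s using Finset.induction_on with
  | empty => simp
  | insert k s hk ih =>
    have h1 := ih fun i hi => hp i (Finset.mem_insert_of_mem hi)
    have h2 : ∑ j, C (p j) * C (ψ k (Pi.single j 1)) = (0 : MvPolynomial σ K) := by
      simp_rw [← C_mul, ← map_sum, mul_comm (p _)]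
      rw [sum_apply_single_mul, hp k (Finset.mem_insert_self _ _), map_zero]
    rw [Finset.prod_insert hk]
    simp_rw [Derivation.leibniz, hpd, smul_eq_mul, mul_add, Finset.sum_add_distrib]
    calc _ = linearPoly (ψ k) * ∑ j, C (p j) * pderiv j (∏ i ∈ s, linearPoly (ψ i))
          + (∏ i ∈ s, linearPoly (ψ i)) * ∑ j, C (p j) * C (ψ k (Pi.single j 1)) := by
          rw [Finset.mul_sum, Finset.mul_sum]
          congr 1 <;> exact Finset.sum_congr rfl fun j _ => by ring
      _ = 0 := by rw [h1, h2]; ring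

/-- A line arrangement with a modular point `p` of multiplicity `m + 1`, and `n` lines not through
`p`, is free with exponents `(1, m, n)`. -/
theorem isFreeWithExponents_of_modular_point [CharZero K]
    (A : HyperplaneArrangement K (Fin 3 → K)) {p : Fin 3 → K} (hp : p ≠ 0)
    (hmod : ∀ H₁ ∈ A.hyperplanes, ∀ H₂ ∈ A.hyperplanes, p ∉ H₁ → p ∉ H₂ → H₁ ≠ H₂ →
      ∃ L ∈ A.hyperplanes, p ∈ L ∧ H₁ ⊓ H₂ ≤ L) {m n : ℕ}
    (hm : {H | H ∈ A.hyperplanes ∧ p ∈ H}.ncard = m + 1)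
    (hn : {H | H ∈ A.hyperplanes ∧ p ∉ H}.ncard = n) :
    A.IsFreeWithExponents ![1, m, n] := by
  classical
  -- Equations of lines off `p` are normalised to take the value 1 at `p`; differences of two of
  -- them then vanish at `p`.
  have hex : ∀ H, ∃ f : Module.Dual K (Fin 3 → K),
      H ∈ A.hyperplanes → (f ≠ 0 ∧ H = LinearMap.ker f) ∧ (p ∉ H → f p = 1) := by
    intro H
    by_cases hH : H ∈ A.hyperplanes
    · obtain ⟨f, hf, rfl⟩ := A.isHyperplane H hH
      by_cases hpf : f p = 0
      · exact ⟨f, fun _ => ⟨⟨hf, rfl⟩, fun h => absurd hpf h⟩⟩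
      · refine ⟨(f p)⁻¹ • f, fun _ => ⟨⟨smul_ne_zero (inv_ne_zero hpf) hf, ?_⟩, fun _ => ?_⟩⟩
        · exact (LinearMap.ker_smul f _ (inv_ne_zero hpf)).symm
        · simp [hpf]
    · exact ⟨0, fun h => absurd h hH⟩
  choose φ hφ0 using hex
  have hφ := fun H hH => (hφ0 H hH).1
  have hφp := fun H hH => (hφ0 H hH).2
  set J := A.finite.toFinset.filter (p ∈ ·) with hJ
  set I := A.finite.toFinset.filter (p ∉ ·) with hI
  have memJ : ∀ {H}, H ∈ J ↔ H ∈ A.hyperplanes ∧ p ∈ H := by simp [hJ]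
  have memI : ∀ {H}, H ∈ I ↔ H ∈ A.hyperplanes ∧ p ∉ H := by simp [hI]
  have cardJ : J.card = m + 1 := by
    rw [← hm, ← Set.ncard_coe_finset]; congr 1; ext H; simp [memJ]
  have cardI : I.card = n := by
    rw [← hn, ← Set.ncard_coe_finset]; congr 1; ext H; simp [memI]
  have hφJ : ∀ H ∈ J, φ H p = 0 := fun H hH => by
    have := (memJ.1 hH).2
    rwa [(hφ H (memJ.1 hH).1).2, LinearMap.mem_ker] at this
  set Q := ∏ H ∈ J, linearPoly (φ H) with hQ
  set P := ∏ H ∈ I, linearPoly (φ H) with hP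
  have homQ : Q.IsHomogeneous (m + 1) := by
    have := IsHomogeneous.prod J (fun H => linearPoly (φ H)) (fun _ => 1)
      fun H _ => isHomogeneous_linearPoly (φ H)
    simpa [cardJ] using this
  have homP : P.IsHomogeneous n := by
    have := IsHomogeneous.prod I (fun H => linearPoly (φ H)) (fun _ => 1)
      fun H _ => isHomogeneous_linearPoly (φ H)
    simpa [cardI] using this
  have euler := homQ.sum_X_mul_pderiv
  have hpQ := sum_C_mul_pderiv_prod_eq_zero J φ p hφJ
  rw [← hQ] at hpQ
  -- With `w · p = 1`, the vector `w × ∇Q` satisfies `(w × ∇Q) × p = ∇Q`, because `p · ∇Q = 0`. This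
  -- is what makes the Saito determinant computable.
  obtain ⟨w, hw⟩ : ∃ w : Fin 3 → K, w 0 * p 0 + w 1 * p 1 + w 2 * p 2 = 1 := by
    obtain ⟨j, hj⟩ := Function.ne_iff.1 hp
    refine ⟨Pi.single j (p j)⁻¹, ?_⟩
    have hj' : p j ≠ 0 := hj
    fin_cases j <;> simpa using inv_mul_cancel₀ hj'
  -- the lift of a derivation killing `Q`
  set v : Fin 3 → MvPolynomial (Fin 3) K :=
    ![C (w 1) * pderiv 2 Q - C (w 2) * pderiv 1 Q, C (w 2) * pderiv 0 Q - C (w 0) * pderiv 2 Q,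
      C (w 0) * pderiv 1 Q - C (w 1) * pderiv 0 Q] with hv
  have homv : ∀ j, (v j).IsHomogeneous m := by
    have h : ∀ (c : K) i, (C c * pderiv i Q).IsHomogeneous m := fun c i =>
      (homQ.pderiv (i := i)).C_mul c
    intro j
    fin_cases j <;> exact (h _ _).sub (h _ _)
  -- Modulo `φ H` the gradient of `Q` is a multiple of that of `φ H`, so its triple product with `w`
  -- and the gradient of `φ H` vanishes.
  have hvJ : ∀ H ∈ J, linearPoly (φ H) ∣ mkDerivation K v (linearPoly (φ H)) := by
    intro H hH
    obtain ⟨q, hq⟩ : linearPoly (φ H) ∣ Q := Finset.dvd_prod_of_mem _ hH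
    have hd : ∀ j, pderiv j Q = linearPoly (φ H) * pderiv j q
        + q * C (φ H (Pi.single j 1)) := by
      intro j
      rw [hq, Derivation.leibniz, derivation_linearPoly (pderiv j)]
      simp [pderiv_X, Pi.single_apply]
    rw [mkDerivation_linearPoly, Fin.sum_univ_three, hv]
    simp only [Matrix.cons_val, hd]
    refine ⟨C (φ H (Pi.single 0 1)) * (C (w 1) * pderiv 2 q - C (w 2) * pderiv 1 q)
      + C (φ H (Pi.single 1 1)) * (C (w 2) * pderiv 0 q - C (w 0) * pderiv 2 q)
      + C (φ H (Pi.single 2 1)) * (C (w 0) * pderiv 1 q - C (w 1) * pderiv 0 q), by ring⟩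
  -- Modularity enters here: `φ H - φ H'` vanishes at `p` and on `H ⊓ H'`, so it is proportional to
  -- the equation of a line `L` through `p`, where divisibility is known.
  obtain ⟨g₀, hg₀⟩ : ∃ g, ∀ H ∈ I, linearPoly (φ H) ∣
      mkDerivation K v (linearPoly (φ H)) - g := by
    refine exists_forall_linearPoly_dvd_sub I φ p (fun H hH => hφp H (memI.1 hH).1 (memI.1 hH).2)
      ?_ _ ?_
    · intro H hH H' hH' h
      rw [(hφ H (memI.1 hH).1).2, h, ← (hφ H' (memI.1 hH').1).2]
    · intro H hH H' hH' hne
      obtain ⟨hHA, hpH⟩ := memI.1 hH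
      obtain ⟨hHA', hpH'⟩ := memI.1 hH'
      obtain ⟨L, hL, hpL, hle⟩ := hmod H hHA H' hHA' hpH hpH' hne
      have hspan := mem_span_of_iInf_ker_le_ker (ι := Bool)
        (L := fun b => cond b (φ H) (φ H')) (K := φ L) (by
          rw [← (hφ L hL).2, iInf_bool_eq]
          simpa only [cond, ← (hφ H hHA).2, ← (hφ H' hHA').2] using hle)
      have hrange : Set.range (fun b => cond b (φ H) (φ H')) = {φ H', φ H} := by
        ext f; simp
      rw [hrange, Submodule.mem_span_pair] at hspan
      obtain ⟨a, b, hab⟩ := hspan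
      have h0 := hφJ L (memJ.2 ⟨hL, hpL⟩)
      rw [← hab, LinearMap.add_apply, LinearMap.smul_apply, LinearMap.smul_apply,
        hφp H hHA hpH, hφp H' hHA' hpH', smul_eq_mul, smul_eq_mul, mul_one, mul_one] at h0
      obtain rfl : a = -b := eq_neg_of_add_eq_zero_left h0
      have hab' : φ L = b • (φ H - φ H') := by rw [← hab]; module
      have hb : b ≠ 0 := fun hb => (hφ L hL).1 (by simp [hab', hb])
      have h2 : φ H - φ H' = b⁻¹ • φ L := by rw [hab', smul_smul, inv_mul_cancel₀ hb, one_smul]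
      rw [h2, linearPoly_smul, ← smul_eq_C_mul, Derivation.map_smul, smul_eq_C_mul, smul_eq_C_mul]
      exact mul_dvd_mul_left _ (hvJ L (memJ.2 ⟨hL, hpL⟩))
  set g := homogeneousComponent m g₀ with hgdef
  have homg : g.IsHomogeneous m := homogeneousComponent_isHomogeneous m g₀
  have hg : ∀ H ∈ I, linearPoly (φ H) ∣ mkDerivation K v (linearPoly (φ H)) - g := by
    intro H hH
    have h1 := linearPoly_dvd_homogeneousComponent (φ H) (hg₀ H hH) m
    rwa [map_sub, homogeneousComponent_eq_self] at h1
    rw [mkDerivation_linearPoly]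
    exact IsHomogeneous.sum _ _ _ fun i _ => (homv i).C_mul _
  have hsum : ∀ (f : Module.Dual K (Fin 3 → K)) (q : MvPolynomial (Fin 3) K),
      ∑ i, C (f (Pi.single i 1)) * (q * C (p i)) = q * C (f p) := by
    intro f q
    rw [← sum_apply_single_mul f p, map_sum, Finset.mul_sum]
    exact Finset.sum_congr rfl fun i _ => by rw [C_mul]; ring
  let D : Fin 3 → Fin 3 → MvPolynomial (Fin 3) K :=
    ![X, fun j => v j - g * C (p j), fun j => P * C (p j)]
  have hD : ∀ i, mkDerivation K (D i) ∈ A.derivationModule := by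
    intro i
    refine mem_derivationModule_of_dvd hφ fun H hH => ?_
    rw [mkDerivation_linearPoly]
    fin_cases i
    · exact dvd_of_eq rfl
    · simp only [D, Fin.mk_one, Matrix.cons_val, mul_sub, Finset.sum_sub_distrib, hsum]
      rw [← mkDerivation_linearPoly]
      by_cases hpH : p ∈ H
      · rw [hφJ H (memJ.2 ⟨hH, hpH⟩), map_zero, mul_zero, sub_zero]
        exact hvJ H (memJ.2 ⟨hH, hpH⟩)
      · rw [hφp H hH hpH, map_one, mul_one]
        exact hg H (memI.2 ⟨hH, hpH⟩)
    · simp only [D, Fin.reduceFinMk, Matrix.cons_val, hsum]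
      by_cases hpH : p ∈ H
      · rw [hφJ H (memJ.2 ⟨hH, hpH⟩), map_zero, mul_zero]
        exact dvd_zero _
      · exact (Finset.dvd_prod_of_mem (fun H => linearPoly (φ H)) (memI.2 ⟨hH, hpH⟩)).mul_right _
  obtain ⟨B, hB⟩ := exists_basis_derivationModule A φ hφ (fun i => ⟨_, hD i⟩) (by
    have hQP : ∏ H ∈ A.finite.toFinset, linearPoly (φ H) = Q * P :=
      (Finset.prod_filter_mul_prod_filter_not _ _ _).symm
    -- The `g` term drops out against the third row, leaving `P` times `x · ∇Q`, which is `(m + 1)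
    -- Q` by Euler. Characteristic zero makes `m + 1` a unit.
    have hdet : (Matrix.of fun i j => mkDerivation K (D i) (X j)).det =
        C ((m + 1 : ℕ) : K) * (Q * P) := by
      have hw' : C (w 0) * C (p 0) + C (w 1) * C (p 1) + C (w 2) * C (p 2)
          = (1 : MvPolynomial (Fin 3) K) := by
        rw [← C_mul, ← C_mul, ← C_mul, ← C_add, ← C_add, hw, C_1]
      rw [Fin.sum_univ_three, nsmul_eq_mul] at euler
      rw [Fin.sum_univ_three] at hpQ
      rw [Matrix.det_fin_three]
      simp only [Matrix.of_apply, mkDerivation_X, D, Matrix.cons_val, hv, map_natCast]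
      linear_combination P * (X 0 * pderiv 0 Q + X 1 * pderiv 1 Q + X 2 * pderiv 2 Q) * hw'
        + P * euler - P * (C (w 0) * X 0 + C (w 1) * X 1 + C (w 2) * X 2) * hpQ
    rw [hQP]
    have hu : IsUnit (C ((m + 1 : ℕ) : K) : MvPolynomial (Fin 3) K) :=
      (Ne.isUnit (Nat.cast_ne_zero.2 m.succ_ne_zero)).map C
    exact (hdet ▸ (hu.mul_left_dvd).2 dvd_rfl))
  refine ⟨B, fun i j => ?_⟩
  rw [hB, mkDerivation_X]
  fin_cases i
  · exact isHomogeneous_X K j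
  · simpa [D] using (homv j).sub (homg.mul (isHomogeneous_C _ (p j)))
  · simpa [D] using homP.mul (isHomogeneous_C _ (p j))

end ModularPoint

end HyperplaneArrangement

namespace HyperplaneArrangement

/-! ### Supersolvability from a modular point -/

section Supersolvable

variable {K V : Type*} [Field K] [AddCommGroup V] [Module K V] (A : HyperplaneArrangement K V)

theorem mem_flats_of_mem {H : Submodule K V} (hH : H ∈ A.hyperplanes) : H ∈ A.flats :=
  ⟨{H}, Set.singleton_subset_iff.2 hH, sInf_singleton.symm⟩

theorem top_mem_flats : ⊤ ∈ A.flats := ⟨∅, Set.empty_subset _, sInf_empty.symm⟩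

theorem coe_sup_flats {X Y : A.flats} (h : X.1 ⊔ Y.1 ∈ A.flats) :
    (X ⊔ Y : A.flats).1 = X.1 ⊔ Y.1 :=
  le_antisymm (sup_le (c := (⟨_, h⟩ : A.flats)) (le_sup_left : X.1 ≤ X.1 ⊔ Y.1)
      (le_sup_right : Y.1 ≤ X.1 ⊔ Y.1))
    (sup_le (le_sup_left : X ≤ X ⊔ Y) (le_sup_right : Y ≤ X ⊔ Y))

/-- Subspaces form a modular lattice. When sums with `X` stay flats, joins of flats agree with sums
where needed, and the modular law is inherited. -/
theorem isModularElement_toDual {X : A.flats} (h : ∀ Y ∈ A.flats, X.1 ⊔ Y ∈ A.flats) :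
    IsModularElement (OrderDual.toDual X : A.IntersectionLattice) := by
  suffices ∀ Y Z : A.flats, Y ≤ Z → Z ⊓ (X ⊔ Y) = (Z ⊓ X) ⊔ Y from
    fun y z hzy => this (OrderDual.ofDual y) (OrderDual.ofDual z) hzy
  intro Y Z hYZ
  have h1 : Z.1 ⊓ X.1 ⊔ Y.1 = Z.1 ⊓ (X.1 ⊔ Y.1) := by
    rw [inf_comm Z.1, inf_comm Z.1, sup_comm, sup_comm X.1]
    exact (sup_inf_assoc_of_le X.1 hYZ).symm
  have h2 : (Z ⊓ X : A.flats).1 ⊔ Y.1 ∈ A.flats := by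
    change Z.1 ⊓ X.1 ⊔ Y.1 ∈ A.flats
    rw [h1]
    exact A.inf_mem_flats Z.2 (h Y Y.2)
  refine Subtype.ext ?_
  rw [A.coe_sup_flats h2]
  change Z.1 ⊓ (X ⊔ Y : A.flats).1 = Z.1 ⊓ X.1 ⊔ Y.1
  rw [A.coe_sup_flats (h Y Y.2), h1]

theorem isCoatom_of_mem {H : Submodule K V} (hH : H ∈ A.hyperplanes) : IsCoatom H := by
  obtain ⟨f, hf, rfl⟩ := A.isHyperplane H hH
  exact LinearMap.isCoatom_ker_of_surjective (LinearMap.surjective hf)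

theorem isAtom_inf [FiniteDimensional K V] (hV : Module.finrank K V = 3) {H L : Submodule K V}
    (hH : IsCoatom H) (hL : IsCoatom L) (hne : H ≠ L) : IsAtom (H ⊓ L) := by
  have hrank : ∀ {N : Submodule K V}, IsCoatom N → Module.finrank K N = 2 := by
    intro N hN
    have := (isSimpleModule_iff_isCoatom.2 hN)
    have h1 := (isSimpleModule_iff_finrank_eq_one (R := K) (M := V ⧸ N)).1 this
    have := N.finrank_quotient_add_finrank
    omega
  have hsup : H ⊔ L = ⊤ := hH.sup_eq_top_of_ne hL hne
  have := Submodule.finrank_sup_add_finrank_inf_eq H L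
  rw [hsup, finrank_top, hV, hrank hH, hrank hL] at this
  rw [← isSimpleModule_iff_isAtom, isSimpleModule_iff_finrank_eq_one]
  omega

/-- A line arrangement with a modular point is supersolvable. -/
theorem isSupersolvable_of_modular_point [FiniteDimensional K V] (hV : Module.finrank K V = 3)
    {O L₀ L₁ H₀ : Submodule K V} (hO : IsAtom O)
    (hL₀ : L₀ ∈ A.hyperplanes) (hL₁ : L₁ ∈ A.hyperplanes) (hL : L₀ ≠ L₁) (hOL₀ : O ≤ L₀)
    (hOL₁ : O ≤ L₁) (hH₀ : H₀ ∈ A.hyperplanes) (hOH₀ : ¬ O ≤ H₀)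
    (hmod : ∀ H₁ ∈ A.hyperplanes, ∀ H₂ ∈ A.hyperplanes, ¬ O ≤ H₁ → ¬ O ≤ H₂ → H₁ ≠ H₂ →
      ∃ L ∈ A.hyperplanes, O ≤ L ∧ H₁ ⊓ H₂ ≤ L) : A.IsSupersolvable := by
  have hOinf : O = L₀ ⊓ L₁ :=
    ((isAtom_inf hV (A.isCoatom_of_mem hL₀) (A.isCoatom_of_mem hL₁) hL).le_iff_eq
      hO.1).1 (le_inf hOL₀ hOL₁)
  have hOF : O ∈ A.flats :=
    hOinf ▸ A.inf_mem_flats (A.mem_flats_of_mem hL₀) (A.mem_flats_of_mem hL₁)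
  have hbot : ⊥ ∈ A.flats := by
    have : H₀ ⊓ O = ⊥ := by
      rw [inf_comm]
      exact (hO.not_le_iff_disjoint.1 hOH₀).eq_bot
    exact this ▸ A.inf_mem_flats (A.mem_flats_of_mem hH₀) hOF
  have hcov : O ⋖ L₀ := by
    rw [hOinf, inf_comm]
    refine inf_covBy_of_covBy_sup_left ?_
    rw [sup_comm, (A.isCoatom_of_mem hL₀).sup_eq_top_of_ne (A.isCoatom_of_mem hL₁) hL]
    exact (A.isCoatom_of_mem hL₁).covBy_top
  -- If `O` is not in `Y`, then `Y` is the whole space, a line `H` off `O`, or lies in a point `H ⊓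
  -- L` with `O ≤ L`. In the last case `O ⊔ Y` is `O` or, by the modular law, `L`.
  have hsupO : ∀ Y ∈ A.flats, O ⊔ Y ∈ A.flats := by
    rintro _ ⟨s, hs, rfl⟩
    by_cases hle : O ≤ sInf s
    · rw [sup_eq_right.2 hle]; exact ⟨s, hs, rfl⟩
    obtain ⟨H, hHs, hOH⟩ : ∃ H ∈ s, ¬ O ≤ H := by
      by_contra! h
      exact hle (le_sInf h)
    have hHO : O ⊔ H = ⊤ := by
      exact (A.isCoatom_of_mem (hs hHs)).2 _ (right_lt_sup.2 hOH)
    by_cases hsH : s = {H}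
    · rw [hsH, sInf_singleton, hHO]; exact A.top_mem_flats
    obtain ⟨H', hH's, hne⟩ : ∃ H' ∈ s, H' ≠ H := by
      by_contra! h
      exact hsH (Set.eq_singleton_iff_unique_mem.2 ⟨hHs, h⟩)
    obtain ⟨L, hLA, hOL, hle⟩ : ∃ L ∈ A.hyperplanes, O ≤ L ∧ H ⊓ H' ≤ L := by
      by_cases hOH' : O ≤ H'
      · exact ⟨H', hs hH's, hOH', inf_le_right⟩
      · exact hmod H (hs hHs) H' (hs hH's) hOH hOH' hne.symm
    have hHL : H ≠ L := fun h => hOH (h ▸ hOL)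
    have hY : sInf s ≤ H ⊓ L :=
      le_inf (sInf_le hHs) ((le_inf (sInf_le hHs) (sInf_le hH's)).trans hle)
    rcases (isAtom_inf hV (A.isCoatom_of_mem (hs hHs)) (A.isCoatom_of_mem hLA) hHL).le_iff.1 hY
      with h | h
    · rw [h, sup_bot_eq]; exact hOF
    · rw [h, ← sup_inf_assoc_of_le H hOL, hHO, top_inf_eq]
      exact A.mem_flats_of_mem hLA
  have hsupL : ∀ Y ∈ A.flats, L₀ ⊔ Y ∈ A.flats := by
    intro Y _
    rcases (A.isCoatom_of_mem hL₀).le_iff.1 (le_sup_left : L₀ ≤ L₀ ⊔ Y) with h | h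
    · rw [h]; exact A.top_mem_flats
    · rw [h]; exact A.mem_flats_of_mem hL₀
  refine ⟨{x | (OrderDual.ofDual x).1 ∈ ({⊥, O, L₀, ⊤} : Set (Submodule K V))}, ⟨?_, ?_⟩, ?_⟩
  · intro x hx y hy _
    change (OrderDual.ofDual y).1 ≤ (OrderDual.ofDual x).1 ∨
      (OrderDual.ofDual x).1 ≤ (OrderDual.ofDual y).1
    rcases hx with h | h | h | h <;> rcases hy with h' | h' | h' | h' <;> rw [h, h'] <;>
      simp [hOL₀]
  -- Each member of the chain is covered by the next, so a flat comparable with both `O` and `L₀` is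
  -- already in it.
  · intro t ht hct
    refine hct.antisymm fun x hx => ?_
    have hxO := ht.total hx (@hct (OrderDual.toDual ⟨O, hOF⟩) (Or.inr (Or.inl rfl)))
    have hxL := ht.total hx (@hct (OrderDual.toDual ⟨L₀, A.mem_flats_of_mem hL₀⟩)
      (Or.inr (Or.inr (Or.inl rfl))))
    change O ≤ (OrderDual.ofDual x).1 ∨ (OrderDual.ofDual x).1 ≤ O at hxO
    change L₀ ≤ (OrderDual.ofDual x).1 ∨ (OrderDual.ofDual x).1 ≤ L₀ at hxL
    change (OrderDual.ofDual x).1 ∈ ({⊥, O, L₀, ⊤} : Set (Submodule K V))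
    rw [hO.le_iff] at hxO
    rw [(A.isCoatom_of_mem hL₀).le_iff] at hxL
    simp only [Set.mem_insert_iff, Set.mem_singleton_iff]
    rcases hxO with hxO | h | h
    · rcases hxL with (h | h) | hxL
      · exact Or.inr (Or.inr (Or.inr h))
      · exact Or.inr (Or.inr (Or.inl h))
      · rcases hcov.eq_or_eq hxO hxL with h | h <;> simp [h]
    · exact Or.inl h
    · exact Or.inr (Or.inl h)
  · intro x hx
    refine A.isModularElement_toDual (X := OrderDual.ofDual x) fun Y hY => ?_
    rcases hx with h | h | h | h <;> rw [h]
    · rwa [bot_sup_eq]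
    · exact hsupO Y hY
    · exact hsupL Y hY
    · rw [top_sup_eq]; exact A.top_mem_flats

end Supersolvable

end HyperplaneArrangement

/-! ### Arithmetic over `ℤ[a]` and the incidence table -/

/-- The element `u + v a` of `ℤ[a]`, where `a² = -a - 2`, as a complex number. -/
noncomputable def kleinInt (x : ℤ × ℤ) : ℂ := x.1 + x.2 * kleinA

namespace kleinInt

/-- Multiplication in `ℤ[a]`. -/
def mul (x y : ℤ × ℤ) : ℤ × ℤ := (x.1 * y.1 - 2 * (x.2 * y.2), x.1 * y.2 + x.2 * y.1 - x.2 * y.2)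

/-- The dot product of vectors over `ℤ[a]`. -/
def dot (u v : Fin 3 → ℤ × ℤ) : ℤ × ℤ := mul (u 0) (v 0) + mul (u 1) (v 1) + mul (u 2) (v 2)

/-- The cross product of vectors over `ℤ[a]`. -/
def cross (u v : Fin 3 → ℤ × ℤ) : Fin 3 → ℤ × ℤ :=
  ![mul (u 1) (v 2) - mul (u 2) (v 1), mul (u 2) (v 0) - mul (u 0) (v 2),
    mul (u 0) (v 1) - mul (u 1) (v 0)]

/-- The linear forms of the Klein arrangement over `ℤ[a]`. -/
def form : Fin 21 → Fin 3 → ℤ × ℤ :=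
  ![![(1, 0), (0, 0), (0, 0)], ![(0, 0), (1, 0), (0, 0)],
    ![(0, 0), (0, 0), (1, 0)], ![(1, 0), (1, 0), (0, 0)],
    ![(1, 0), (-1, 0), (0, 0)], ![(1, 0), (0, 0), (1, 0)],
    ![(1, 0), (0, 0), (-1, 0)], ![(0, 0), (1, 0), (1, 0)],
    ![(0, 0), (1, 0), (-1, 0)], ![(1, 0), (1, 0), (0, 1)],
    ![(1, 0), (1, 0), (0, -1)], ![(1, 0), (-1, 0), (0, 1)],
    ![(1, 0), (-1, 0), (0, -1)], ![(1, 0), (0, 1), (1, 0)],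
    ![(1, 0), (0, 1), (-1, 0)], ![(1, 0), (0, -1), (1, 0)],
    ![(1, 0), (0, -1), (-1, 0)], ![(0, 1), (1, 0), (1, 0)],
    ![(0, 1), (1, 0), (-1, 0)], ![(0, 1), (-1, 0), (1, 0)],
    ![(0, 1), (-1, 0), (-1, 0)]]

/-- The singular points of the Klein arrangement over `ℤ[a]`: first the quadruple points, whose
coordinates are conjugate to those of the linear forms, then the triple points. -/
def point : Fin 49 → Fin 3 → ℤ × ℤ :=
  ![![(1, 0), (0, 0), (0, 0)], ![(0, 0), (1, 0), (0, 0)],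
    ![(0, 0), (0, 0), (1, 0)], ![(1, 0), (1, 0), (0, 0)],
    ![(1, 0), (-1, 0), (0, 0)], ![(1, 0), (0, 0), (1, 0)],
    ![(1, 0), (0, 0), (-1, 0)], ![(0, 0), (1, 0), (1, 0)],
    ![(0, 0), (1, 0), (-1, 0)], ![(1, 0), (1, 0), (-1, -1)],
    ![(1, 0), (1, 0), (1, 1)], ![(1, 0), (-1, 0), (-1, -1)],
    ![(1, 0), (-1, 0), (1, 1)], ![(1, 0), (-1, -1), (1, 0)],
    ![(1, 0), (-1, -1), (-1, 0)], ![(1, 0), (1, 1), (1, 0)],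
    ![(1, 0), (1, 1), (-1, 0)], ![(-1, -1), (1, 0), (1, 0)],
    ![(-1, -1), (1, 0), (-1, 0)], ![(-1, -1), (-1, 0), (1, 0)],
    ![(-1, -1), (-1, 0), (-1, 0)], ![(-1, 0), (1, 0), (1, 0)],
    ![(1, 0), (1, 0), (-1, 0)], ![(1, 0), (-1, 0), (1, 0)],
    ![(1, 0), (1, 0), (1, 0)], ![(0, 0), (0, -1), (1, 0)],
    ![(0, -1), (0, 0), (1, 0)], ![(1, 0), (-1, 1), (-1, 0)],
    ![(1, -1), (-1, 0), (1, 0)], ![(0, 0), (0, 1), (1, 0)],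
    ![(0, 1), (0, 0), (1, 0)], ![(1, 0), (-1, 1), (1, 0)],
    ![(-1, 1), (1, 0), (1, 0)], ![(-1, 0), (-1, 1), (1, 0)],
    ![(1, -1), (1, 0), (1, 0)], ![(1, 0), (1, -1), (1, 0)],
    ![(-1, 1), (-1, 0), (1, 0)], ![(0, 0), (1, 0), (0, -1)],
    ![(0, -1), (1, 0), (0, 0)], ![(-1, 0), (1, 0), (1, -1)],
    ![(0, 0), (1, 0), (0, 1)], ![(1, 0), (-1, 0), (1, -1)],
    ![(0, 1), (1, 0), (0, 0)], ![(1, 0), (1, 0), (-1, 1)],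
    ![(1, 0), (1, 0), (1, -1)], ![(1, 0), (0, 0), (0, -1)],
    ![(1, 0), (0, -1), (0, 0)], ![(1, 0), (0, 0), (0, 1)],
    ![(1, 0), (0, 1), (0, 0)]]

/-- The set of lines of the Klein arrangement through a singular point, as a bit mask. -/
def mask : Fin 49 → ℕ :=
  ![390, 101, 27, 6164, 1548, 81986, 40994, 786689, 1179777, 140304,
    279056, 561160, 1116168, 164416, 328736, 534592, 1069088, 1057536, 541824, 297088,
    200960, 296, 176, 200, 336, 4609, 2562, 524832, 66176, 3073,
    5122, 1049664, 34048, 133152, 18688, 266304, 12416, 73729, 24580, 270344,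
    49153, 147464, 98308, 1081360, 589840, 655362, 393220, 1310722, 1572868]

/-- Incidence of the lines and the singular points of the Klein arrangement. -/
def inc (i : Fin 21) (k : Fin 49) : Bool := (mask k).testBit i

/-- The point `l` lies on no line of the Klein arrangement through the point `k`. -/
def off (k l : Fin 49) : Bool := mask k &&& mask l == 0

/-- Among the points that are `off` the point `k`, `l` is the first one on its join with `k`. -/
def isFirst (k l : Fin 49) : Bool :=
  off k l && (List.finRange 49).all fun m =>
    !(m < l) || !off k m || !(dot (cross (point k) (point l)) (point m) == 0)

/-- Certifies the table of masks against the coordinates; later incidence checks use only the masks.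
-/
theorem inc_eq : ∀ i k, inc i k = (dot (form i) (point k) == 0) := by decide +kernel

theorem mask_lt : ∀ k, mask k < 2 ^ 21 := by decide +kernel

theorem mask_injective : ∀ k l, mask k = mask l → k = l := by decide +kernel

theorem off_eq (k l : Fin 49) : off k l = true ↔ ∀ i, inc i k = true → inc i l = false := by
  rw [off, beq_iff_eq]
  constructor
  · intro h i hi
    have := Nat.testBit_and (mask k) (mask l) i
    rw [h, Nat.zero_testBit, show (mask k).testBit i = true from hi, Bool.true_and] at this
    exact this.symm
  · intro h
    refine Nat.eq_of_testBit_eq fun i => ?_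
    rw [Nat.testBit_and, Nat.zero_testBit]
    by_cases hi : i < 21
    · by_cases hk : (mask k).testBit i = true
      · rw [show (mask l).testBit i = false from h ⟨i, hi⟩ hk, Bool.and_false]
      · simp [hk]
    · rw [Nat.testBit_eq_false_of_lt ((mask_lt k).trans_le
        (Nat.pow_le_pow_right two_pos (not_lt.1 hi))), Bool.false_and]

theorem eq_of_inc_eq {k l : Fin 49} (h : ∀ i, inc i k = inc i l) : k = l := by
  refine mask_injective k l (Nat.eq_of_testBit_eq fun i => ?_)
  by_cases hi : i < 21
  · exact h ⟨i, hi⟩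
  · have h2 := Nat.pow_le_pow_right two_pos (not_lt.1 hi)
    rw [Nat.testBit_eq_false_of_lt ((mask_lt k).trans_le h2),
      Nat.testBit_eq_false_of_lt ((mask_lt l).trans_le h2)]

theorem exists_inc_ne : ∀ i j, i ≠ j → ∃ k, inc i k = true ∧ inc j k = false := by decide +kernel

/-- Completeness of the list of points: every pair of lines already meets in a listed one. -/
theorem exists_inc : ∀ i j, i ≠ j → ∃ k, inc i k = true ∧ inc j k = true := by decide +kernel

theorem card_inc : ∀ k, (Finset.univ.filter fun i => inc i k = true).card =
    if k < 21 then 4 else 3 := by decide +kernel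

theorem card_off : ∀ k < 21, (Finset.univ.filter fun l => off k l = true).card = 20 := by
  decide +kernel

theorem card_isFirst : ∀ k < 21, (Finset.univ.filter fun l => isFirst k l = true).card = 12 := by
  decide +kernel

end kleinInt

namespace HyperplaneArrangement

/-! ### Points, joins and pencils -/

section Points

variable {K V : Type*} [Field K] [AddCommGroup V] [Module K V]

theorem isAtom_submodule (P : Projectivization K V) : IsAtom P.submodule := by
  rw [P.submodule_eq]
  exact nonzero_span_atom _ P.rep_nonzero

theorem submodule_le_iff (P : Projectivization K V) {H : Submodule K V} :
    P.submodule ≤ H ↔ P.rep ∈ H := by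
  rw [P.submodule_eq, Submodule.span_singleton_le_iff_mem]

theorem submodule_eq_inf [FiniteDimensional K V] (hV : Module.finrank K V = 3)
    {H L : Submodule K V} (hH : IsCoatom H) (hL : IsCoatom L) (hne : H ≠ L)
    {P : Projectivization K V} (hPH : P.submodule ≤ H) (hPL : P.submodule ≤ L) :
    P.submodule = H ⊓ L :=
  ((isAtom_inf hV hH hL hne).le_iff_eq (isAtom_submodule P).1).1 (le_inf hPH hPL)

theorem isCoatom_sup [FiniteDimensional K V] (hV : Module.finrank K V = 3)
    {P Q : Projectivization K V} (hne : P ≠ Q) : IsCoatom (P.submodule ⊔ Q.submodule) := by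
  have h := Submodule.finrank_sup_add_finrank_inf_eq P.submodule Q.submodule
  have hinf : P.submodule ⊓ Q.submodule = ⊥ :=
    ((isAtom_submodule P).disjoint_of_ne (isAtom_submodule Q)
      fun h => hne (Projectivization.submodule_injective h)).eq_bot
  rw [hinf, finrank_bot, P.finrank_submodule, Q.finrank_submodule] at h
  have h2 := (P.submodule ⊔ Q.submodule).finrank_quotient_add_finrank
  rw [← isSimpleModule_iff_isCoatom, isSimpleModule_iff_finrank_eq_one]
  omega

theorem exists_ker_eq_of_isCoatom {H : Submodule K V} (hH : IsCoatom H) :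
    ∃ f : Module.Dual K V, f ≠ 0 ∧ H = LinearMap.ker f := by
  obtain ⟨f, hf, hle⟩ := Submodule.exists_le_ker_of_lt_top H hH.lt_top
  refine ⟨f, hf, (hH.le_iff.1 hle).elim (fun h => absurd (LinearMap.ker_eq_top.1 h) hf) Eq.symm⟩

/-- There are infinitely many hyperplanes through the intersection of two hyperplanes. -/
theorem infinite_setOf_isCoatom_inf_le [Infinite K] {H L : Submodule K V} (hH : IsCoatom H)
    (hL : IsCoatom L) (hne : H ≠ L) : {N | IsCoatom N ∧ H ⊓ L ≤ N}.Infinite := by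
  obtain ⟨f, hf, rfl⟩ := exists_ker_eq_of_isCoatom hH
  obtain ⟨g, hg, rfl⟩ := exists_ker_eq_of_isCoatom hL
  have hcoat : ∀ t : K, IsCoatom (LinearMap.ker (f + t • g)) := by
    intro t
    refine LinearMap.isCoatom_ker_of_surjective (LinearMap.surjective fun h => hne ?_)
    refine (hL.le_iff.1 fun x hx => ?_).resolve_left hH.1
    have := LinearMap.congr_fun h x
    rw [LinearMap.mem_ker] at hx ⊢
    simpa [hx] using this
  refine (Set.infinite_range_of_injective (f := fun t : K => LinearMap.ker (f + t • g)) ?_).mono ?_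
  · intro s t hst
    by_contra hne'
    have hle : LinearMap.ker (f + s • g) ≤ LinearMap.ker g := by
      intro x hx
      have hx' : x ∈ LinearMap.ker (f + t • g) := by
        change _ = LinearMap.ker (f + t • g) at hst
        rwa [← hst]
      rw [LinearMap.mem_ker, LinearMap.add_apply, LinearMap.smul_apply, smul_eq_mul] at hx hx'
      have : (s - t) * g x = 0 := by linear_combination hx - hx'
      exact (mul_eq_zero.1 this).resolve_left (sub_ne_zero.2 hne')
    have heq := (hcoat s).le_iff.1 hle |>.resolve_left hL.1
    refine hne ((hL.le_iff.1 fun x hx => ?_).resolve_left hH.1)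
    have hx' := hx
    rw [heq, LinearMap.mem_ker, LinearMap.add_apply, LinearMap.smul_apply,
      LinearMap.mem_ker.1 hx, smul_zero, add_zero] at hx'
    exact hx'
  · rintro _ ⟨t, rfl⟩
    refine ⟨hcoat t, fun x hx => ?_⟩
    rw [LinearMap.mem_ker, LinearMap.add_apply, LinearMap.smul_apply, LinearMap.mem_ker.1 hx.1,
      LinearMap.mem_ker.1 hx.2, smul_zero, add_zero]

end Points

/-! ### Resolutions from supersolvable extensions -/

section Resolution

variable {K V : Type*} [Field K] [AddCommGroup V] [Module K V]

/-- Only the last term must be supersolvable, so the extra lines may be added one at a time in any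
order. -/
theorem exists_isSupersolvableResolution {A B : HyperplaneArrangement K V}
    (hAB : A.hyperplanes ⊆ B.hyperplanes) {k : ℕ} (hk : B.card = A.card + k)
    (hB : B.IsSupersolvable) :
    ∃ Y, A.IsSupersolvableResolution k Y ∧ Y (Fin.last k) = B := by
  have hcard : (B.hyperplanes \ A.hyperplanes).ncard = k := by
    rw [Set.ncard_sdiff hAB A.finite]
    exact Nat.sub_eq_of_eq_add' hk
  have : Finite ↥(B.hyperplanes \ A.hyperplanes) := B.finite.subset Set.sdiff_subset
  let e := (Finite.equivFinOfCardEq ((Nat.card_coe_set_eq _).trans hcard) :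
    ↥(B.hyperplanes \ A.hyperplanes) ≃ Fin k).symm
  let S : ℕ → Set (Submodule K V) := fun i => (fun j => (e j).1) '' {j | j.1 < i}
  have hS : ∀ i, S i ⊆ B.hyperplanes \ A.hyperplanes := by
    rintro i _ ⟨j, -, rfl⟩
    exact (e j).2
  have hsub : ∀ i, A.hyperplanes ∪ S i ⊆ B.hyperplanes := fun i =>
    Set.union_subset hAB ((hS i).trans Set.sdiff_subset)
  let Y : Fin (k + 1) → HyperplaneArrangement K V := fun i =>
    { hyperplanes := A.hyperplanes ∪ S i
      finite := B.finite.subset (hsub i)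
      isHyperplane := fun H hH => B.isHyperplane H (hsub i hH) }
  have hlast : Y (Fin.last k) = B := by
    refine HyperplaneArrangement.ext ((hsub k).antisymm fun H hH => ?_)
    by_cases hA : H ∈ A.hyperplanes
    · exact Or.inl hA
    · exact Or.inr ⟨e.symm ⟨H, hH, hA⟩, (e.symm ⟨H, hH, hA⟩).2, by simp⟩
  refine ⟨Y, ⟨?_, ?_, ?_, ?_⟩, hlast⟩
  · refine HyperplaneArrangement.ext ?_
    simp [Y, S]
  · intro i j hij
    exact Set.union_subset_union_right _ (Set.image_mono fun l hl => Nat.lt_of_lt_of_le hl hij)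
  · intro i
    have h1 : (S i).ncard = i := by
      rw [(Set.ncard_image_of_injective _ (Subtype.val_injective.comp e.injective) :
        (S i).ncard = _)]
      have : {j : Fin k | j.1 < i.1} = (Fin.castLE (Nat.lt_succ_iff.1 i.2)) '' Set.univ := by
        ext j
        constructor
        · intro hj
          exact ⟨⟨j, hj⟩, trivial, rfl⟩
        · rintro ⟨l, -, rfl⟩
          exact l.2
      rw [this, Set.ncard_image_of_injective _ (Fin.castLE_injective _), Set.ncard_univ,
        Nat.card_eq_fintype_card, Fintype.card_fin]
    change (A.hyperplanes ∪ S i).ncard = A.hyperplanes.ncard + i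
    rw [Set.ncard_union_eq (Set.disjoint_left.2 fun H hH hS' => (hS i hS').2 hH) A.finite
      (B.finite.subset ((hS i).trans Set.sdiff_subset)), h1]
  · rw [hlast]
    exact hB

theorem extSS_le {A : HyperplaneArrangement K V} {k : ℕ}
    {Y : Fin (k + 1) → HyperplaneArrangement K V} (hY : A.IsSupersolvableResolution k Y) :
    A.extSS ≤ k :=
  iInf₂_le k ⟨Y, hY⟩

end Resolution

theorem IsFreeWithExponents.swap {K : Type*} [Field K] {σ : Type*} [Fintype σ] [DecidableEq σ]
    {A : HyperplaneArrangement K (σ → K)} {l m n : ℕ}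
    (h : A.IsFreeWithExponents ![l, m, n]) : A.IsFreeWithExponents ![l, n, m] := by
  obtain ⟨b, hb⟩ := h
  refine ⟨b.reindex (Equiv.swap 1 2), fun i j => ?_⟩
  rw [Module.Basis.reindex_apply]
  convert hb ((Equiv.swap 1 2).symm i) j using 1
  fin_cases i <;> rfl

end HyperplaneArrangement

/-! ### Transfer from `ℤ[a]` to the complex Klein arrangement -/

namespace kleinInt

theorem map_add (x y : ℤ × ℤ) : kleinInt (x + y) = kleinInt x + kleinInt y := by
  simp [kleinInt]; ring

theorem map_sub (x y : ℤ × ℤ) : kleinInt (x - y) = kleinInt x - kleinInt y := by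
  simp [kleinInt]; ring

theorem kleinA_sq : kleinA ^ 2 = -kleinA - 2 := by
  have h : ((Real.sqrt 7 : ℝ) : ℂ) ^ 2 = 7 := by
    rw [← Complex.ofReal_pow, Real.sq_sqrt (by norm_num)]; norm_num
  rw [kleinA]
  linear_combination (1 / 4 : ℂ) * (Complex.I ^ 2 * h + 7 * Complex.I_sq)

theorem map_mul (x y : ℤ × ℤ) : kleinInt (mul x y) = kleinInt x * kleinInt y := by
  simp only [kleinInt, mul, Int.cast_sub, Int.cast_add, Int.cast_mul, Int.cast_ofNat]
  linear_combination (-(x.2 : ℂ) * y.2) * kleinA_sq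

/-- As `a` is not real, `1` and `a` are independent over the integers; vanishing in `ℂ` becomes
decidable. -/
theorem eq_zero_iff {x : ℤ × ℤ} : kleinInt x = 0 ↔ x = 0 := by
  refine ⟨fun h => ?_, fun h => by simp [h, kleinInt]⟩
  have him := congrArg Complex.im h
  have hre := congrArg Complex.re h
  have h7 : Real.sqrt 7 ≠ 0 := by positivity
  have hA : kleinA.im = Real.sqrt 7 / 2 := by simp [kleinA]
  simp only [kleinInt, Complex.add_im, Complex.mul_im, Complex.intCast_im, Complex.intCast_re, hA,
    Complex.zero_im, zero_add, zero_mul, add_zero] at him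
  have h2 : x.2 = 0 := by
    have := (mul_eq_zero.1 him).resolve_right (by positivity)
    exact_mod_cast this
  simp only [kleinInt, h2, Complex.intCast_re, Int.cast_zero, zero_mul,
    Complex.zero_re, add_zero] at hre
  exact Prod.ext (by exact_mod_cast hre) h2

theorem dotForm_apply (v x : Fin 3 → ℂ) : dotForm v x = v 0 * x 0 + v 1 * x 1 + v 2 * x 2 := by
  simp [dotForm, Fin.sum_univ_three]

theorem dotForm_eq_zero_iff (u v : Fin 3 → ℤ × ℤ) :
    dotForm (fun j => kleinInt (u j)) (fun j => kleinInt (v j)) = 0 ↔ dot u v = 0 := by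
  rw [← eq_zero_iff, dotForm_apply, dot, map_add, map_add, map_mul, map_mul, map_mul]

theorem kleinForm_eq (i : Fin 21) : kleinForm i = fun j => kleinInt (form i j) := by
  ext j
  fin_cases i <;> fin_cases j <;> simp [kleinForm, form, kleinInt]

/-- The coordinates of the singular points of the Klein arrangement. -/
noncomputable def vec (k : Fin 49) : Fin 3 → ℂ := fun j => kleinInt (point k j)

theorem exists_point_ne : ∀ k, ∃ j, point k j ≠ 0 := by decide +kernel

theorem vec_ne_zero (k : Fin 49) : vec k ≠ 0 := fun h => by
  obtain ⟨j, hj⟩ := exists_point_ne k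
  exact hj (eq_zero_iff.1 (congrFun h j))

/-- The singular points of the Klein arrangement. -/
noncomputable def singularPoint (k : Fin 49) : Projectivization ℂ (Fin 3 → ℂ) :=
  Projectivization.mk ℂ (vec k) (vec_ne_zero k)

/-- The lines of the Klein arrangement. -/
noncomputable def line (i : Fin 21) : Submodule ℂ (Fin 3 → ℂ) :=
  LinearMap.ker (dotForm (kleinForm i))

theorem hyperplanes_eq : kleinArrangement.hyperplanes = Set.range line := rfl

theorem line_mem (i : Fin 21) : line i ∈ kleinArrangement.hyperplanes := ⟨i, rfl⟩

theorem singularPoint_le_iff {k : Fin 49} {H : Submodule ℂ (Fin 3 → ℂ)} :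
    (singularPoint k).submodule ≤ H ↔ vec k ∈ H := by
  rw [singularPoint, Projectivization.submodule_mk, Submodule.span_singleton_le_iff_mem]

theorem singularPoint_le_line_iff {i : Fin 21} {k : Fin 49} :
    (singularPoint k).submodule ≤ line i ↔ inc i k = true := by
  rw [singularPoint_le_iff, line, LinearMap.mem_ker, kleinForm_eq, inc_eq, beq_iff_eq]
  exact dotForm_eq_zero_iff _ _

theorem line_injective : Function.Injective line := by
  intro i j h
  by_contra hne
  obtain ⟨k, hk, hk'⟩ := exists_inc_ne i j hne
  rw [← singularPoint_le_line_iff, h, singularPoint_le_line_iff, hk'] at hk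
  exact Bool.noConfusion hk

theorem singularPoint_injective : Function.Injective singularPoint := by
  intro k l h
  refine eq_of_inc_eq fun i => ?_
  rw [Bool.eq_iff_iff, ← singularPoint_le_line_iff, h, singularPoint_le_line_iff]

theorem isCoatom_line (i : Fin 21) : IsCoatom (line i) :=
  kleinArrangement.isCoatom_of_mem (line_mem i)

theorem finrank_eq : Module.finrank ℂ (Fin 3 → ℂ) = 3 := by simp

theorem setOf_lines_through (k : Fin 49) :
    {H | H ∈ kleinArrangement.hyperplanes ∧ (singularPoint k).submodule ≤ H} =
      line '' {i | inc i k = true} := by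
  ext H
  constructor
  · rintro ⟨⟨i, rfl⟩, h⟩
    exact ⟨i, singularPoint_le_line_iff.1 h, rfl⟩
  · rintro ⟨i, hi, rfl⟩
    exact ⟨line_mem i, singularPoint_le_line_iff.2 hi⟩

theorem multiplicity_singularPoint (k : Fin 49) :
    kleinArrangement.multiplicity (singularPoint k) = if k < 21 then 4 else 3 := by
  rw [HyperplaneArrangement.multiplicity, setOf_lines_through,
    Set.ncard_image_of_injective _ line_injective, ← card_inc k, ← Set.ncard_coe_finset]
  simp

theorem exists_eq_singularPoint {P : Projectivization ℂ (Fin 3 → ℂ)}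
    (hP : 2 ≤ kleinArrangement.multiplicity P) : ∃ k, P = singularPoint k := by
  obtain ⟨_, ⟨⟨i, rfl⟩, hi⟩, _, ⟨⟨j, rfl⟩, hj⟩, hne⟩ :=
    (Set.one_lt_ncard (kleinArrangement.finite.subset fun _ h => h.1)).1 hP
  obtain ⟨k, hki, hkj⟩ := exists_inc i j fun h => hne (h ▸ rfl)
  refine ⟨k, Projectivization.submodule_injective ?_⟩
  rw [HyperplaneArrangement.submodule_eq_inf finrank_eq (isCoatom_line i) (isCoatom_line j) hne hi
    hj, HyperplaneArrangement.submodule_eq_inf finrank_eq (isCoatom_line i) (isCoatom_line j) hne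
    (singularPoint_le_line_iff.2 hki) (singularPoint_le_line_iff.2 hkj)]

theorem exists_eq_singularPoint_of_multiplicity_eq_four {P : Projectivization ℂ (Fin 3 → ℂ)}
    (hP : kleinArrangement.multiplicity P = 4) : ∃ k < 21, P = singularPoint k := by
  obtain ⟨k, rfl⟩ := exists_eq_singularPoint (P := P) (by rw [hP]; norm_num)
  refine ⟨k, ?_, rfl⟩
  by_contra hk
  rw [multiplicity_singularPoint, if_neg hk] at hP
  norm_num at hP

theorem card_kleinArrangement : kleinArrangement.card = 21 := by
  rw [HyperplaneArrangement.card, hyperplanes_eq, ← Set.image_univ,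
    Set.ncard_image_of_injective _ line_injective, Set.ncard_univ, Nat.card_eq_fintype_card,
    Fintype.card_fin]

theorem t_eq {r : ℕ} (hr : 2 ≤ r) :
    kleinArrangement.t r =
      (Finset.univ.filter fun k : Fin 49 => (if k < 21 then 4 else 3) = r).card := by
  rw [HyperplaneArrangement.t, ← Set.ncard_coe_finset,
    ← Set.ncard_image_of_injective _ singularPoint_injective]
  congr 1
  ext P
  simp only [Set.mem_ofPred_eq, Set.mem_image, Finset.coe_filter, Finset.mem_univ, true_and]
  constructor
  · intro hP
    obtain ⟨k, rfl⟩ := exists_eq_singularPoint (hP ▸ hr)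
    exact ⟨k, by rw [← multiplicity_singularPoint, hP], rfl⟩
  · rintro ⟨k, hk, rfl⟩
    rw [multiplicity_singularPoint, hk]

theorem singOff_eq (k : Fin 49) :
    kleinArrangement.singOff (singularPoint k) = singularPoint '' {l | off k l = true} := by
  ext P
  constructor
  · rintro ⟨hP, h⟩
    obtain ⟨l, rfl⟩ := exists_eq_singularPoint hP
    refine ⟨l, (off_eq k l).2 fun i hi => ?_, rfl⟩
    have := h _ (line_mem i) (singularPoint_le_line_iff.2 hi)
    rwa [singularPoint_le_line_iff, Bool.not_eq_true] at this
  · rintro ⟨l, hl, rfl⟩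
    refine ⟨by rw [multiplicity_singularPoint]; split_ifs <;> norm_num, ?_⟩
    rintro _ ⟨i, rfl⟩ hi
    change ¬ (singularPoint l).submodule ≤ line i
    rw [singularPoint_le_line_iff, (off_eq k l).1 hl i (singularPoint_le_line_iff.1 hi)]
    exact Bool.noConfusion

theorem ncard_singOff {k : Fin 49} (hk : k < 21) :
    (kleinArrangement.singOff (singularPoint k)).ncard = 20 := by
  rw [singOff_eq, Set.ncard_image_of_injective _ singularPoint_injective, ← card_off k hk,
    ← Set.ncard_coe_finset]
  simp

theorem off_self : ∀ k, off k k = false := by decide +kernel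

/-- The cross product is orthogonal to both vectors, and nonzero because distinct points have
independent vectors; the join, being a coatom, is its whole kernel. -/
theorem sup_eq_ker {k l : Fin 49} (hkl : k ≠ l) :
    (singularPoint k).submodule ⊔ (singularPoint l).submodule =
      LinearMap.ker (dotForm fun j => kleinInt (cross (point k) (point l) j)) := by
  have hco := HyperplaneArrangement.isCoatom_sup finrank_eq (singularPoint_injective.ne hkl)
  have hcross : ∀ j, kleinInt (cross (point k) (point l) j) =
      ![vec k 1 * vec l 2 - vec k 2 * vec l 1, vec k 2 * vec l 0 - vec k 0 * vec l 2,
        vec k 0 * vec l 1 - vec k 1 * vec l 0] j := by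
    intro j
    fin_cases j <;> simp [cross, map_sub, map_mul, vec]
  refine ((hco.le_iff.1 (sup_le ?_ ?_)).resolve_left ?_).symm
  · rw [singularPoint_le_iff, LinearMap.mem_ker, dotForm_apply]
    simp only [hcross, Matrix.cons_val]
    ring
  · rw [singularPoint_le_iff, LinearMap.mem_ker, dotForm_apply]
    simp only [hcross, Matrix.cons_val]
    ring
  · rw [LinearMap.ker_eq_top]
    refine dotForm_ne_zero ?_
    have hne := singularPoint_injective.ne hkl
    rw [singularPoint, singularPoint, Ne, Projectivization.mk_eq_mk_iff'] at hne
    have h1 : LinearIndependent ℂ ![vec l, vec k] :=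
      (LinearIndependent.pair_iff' (vec_ne_zero l)).2 fun c hc => hne ⟨c, hc⟩
    have h2 := crossProduct_ne_zero_iff_linearIndependent.2 h1
    rw [← cross_anticomm, neg_ne_zero, cross_apply] at h2
    intro h
    exact h2 (by rw [← h]; exact (funext hcross).symm)

theorem sup_eq_sup_iff {k l m : Fin 49} (hkl : k ≠ l) (hkm : k ≠ m) :
    (singularPoint k).submodule ⊔ (singularPoint l).submodule =
      (singularPoint k).submodule ⊔ (singularPoint m).submodule ↔
      dot (cross (point k) (point l)) (point m) = 0 := by
  have hl := HyperplaneArrangement.isCoatom_sup finrank_eq (singularPoint_injective.ne hkl)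
  have hm := HyperplaneArrangement.isCoatom_sup finrank_eq (singularPoint_injective.ne hkm)
  rw [← dotForm_eq_zero_iff, ← LinearMap.mem_ker, ← sup_eq_ker hkl]
  change _ ↔ vec m ∈ _
  rw [← singularPoint_le_iff]
  constructor
  · intro h
    rw [h]
    exact le_sup_right
  · intro h
    exact (hm.le_iff.1 (sup_le le_sup_left h)).resolve_left hl.1

theorem ne_of_off {k l : Fin 49} (h : off k l = true) : k ≠ l := by
  rintro rfl
  rw [off_self] at h
  exact Bool.noConfusion h

theorem isFirst_iff {k l : Fin 49} : isFirst k l = true ↔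
    off k l = true ∧ ∀ m < l, off k m = true → dot (cross (point k) (point l)) (point m) ≠ 0 := by
  simp only [isFirst, Bool.and_eq_true, List.all_eq_true, List.mem_finRange, true_imp_iff,
    Bool.or_eq_true, Bool.not_eq_true', decide_eq_false_iff_not, beq_eq_false_iff_ne]
  refine and_congr_right fun _ => forall_congr' fun m => ?_
  rw [or_assoc, ← imp_iff_not_or, ← Bool.not_eq_true, ← imp_iff_not_or]

theorem ncard_joins {k : Fin 49} (hk : k < 21) :
    (kleinArrangement.joins (singularPoint k)).ncard = 12 := by
  let f : Fin 49 → Submodule ℂ (Fin 3 → ℂ) := fun l =>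
    (singularPoint k).submodule ⊔ (singularPoint l).submodule
  -- Each join is represented by the listed point of least index on it, so counting distinct lines
  -- becomes a decidable count of indices.
  have himage : kleinArrangement.joins (singularPoint k) = f '' {l | isFirst k l = true} := by
    ext H
    constructor
    · rintro ⟨P, hP, rfl⟩
      rw [singOff_eq] at hP
      obtain ⟨l, hl, rfl⟩ := hP
      obtain ⟨m, ⟨hm, hml⟩, hmin⟩ := WellFounded.has_min (wellFounded_lt (α := Fin 49))
        {m | off k m = true ∧ f m = f l} ⟨l, hl, rfl⟩
      refine ⟨m, isFirst_iff.2 ⟨hm, fun m' hm' hoff h0 => ?_⟩, hml⟩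
      refine hmin m' ⟨hoff, ?_⟩ hm'
      rw [← hml]
      exact ((sup_eq_sup_iff (ne_of_off hm) (ne_of_off hoff)).2 h0).symm
    · rintro ⟨l, hl, rfl⟩
      exact ⟨singularPoint l, singOff_eq k ▸ ⟨l, (isFirst_iff.1 hl).1, rfl⟩, rfl⟩
  have hinj : Set.InjOn f {l | isFirst k l = true} := by
    have key : ∀ l m, isFirst k l = true → isFirst k m = true → f l = f m → ¬ m < l := by
      intro l m hl hm h hlt
      have hl := isFirst_iff.1 hl
      have hm := (isFirst_iff.1 hm).1
      exact hl.2 m hlt hm ((sup_eq_sup_iff (ne_of_off hl.1) (ne_of_off hm)).1 h)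
    intro l hl m hm h
    exact le_antisymm (not_lt.1 (key l m hl hm h)) (not_lt.1 (key m l hm hl h.symm))
  rw [himage, hinj.ncard_image, ← card_isFirst k hk, ← Set.ncard_coe_finset]
  simp

end kleinInt

/-! ### Adding lines through a quadruple point -/

namespace HyperplaneArrangement

theorem le_of_mem_joins {K V : Type*} [Field K] [AddCommGroup V] [Module K V]
    {A : HyperplaneArrangement K V} {O : Projectivization K V} {H : Submodule K V}
    (hH : H ∈ A.joins O) : O.submodule ≤ H := by
  obtain ⟨P, -, rfl⟩ := hH
  exact le_sup_left

theorem isCoatom_of_mem_joins {O : Projectivization ℂ (Fin 3 → ℂ)}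
    (hO : kleinArrangement.multiplicity O = 4)
    {H : Submodule ℂ (Fin 3 → ℂ)} (hH : H ∈ kleinArrangement.joins O) :
    IsCoatom H := by
  obtain ⟨P, hP, rfl⟩ := hH
  refine isCoatom_sup kleinInt.finrank_eq ?_
  rintro rfl
  obtain ⟨H, hH, hOH⟩ := Set.nonempty_of_ncard_ne_zero (hO ▸ four_ne_zero)
  exact hP.2 H hH hOH hOH

theorem exists_ne_mem_klein {O : Projectivization ℂ (Fin 3 → ℂ)}
    (hO : kleinArrangement.multiplicity O = 4)
    : ∃ L₀ ∈ kleinArrangement.hyperplanes,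
    ∃ L₁ ∈ kleinArrangement.hyperplanes, L₀ ≠ L₁ ∧ O.submodule ≤ L₀ ∧ O.submodule ≤ L₁ := by
  obtain ⟨L₀, h₀, L₁, h₁, hne⟩ :=
    (Set.one_lt_ncard (kleinArrangement.finite.subset fun _ h => h.1)).1
      (show 1 < kleinArrangement.multiplicity O by rw [hO]; norm_num)
  exact ⟨L₀, h₀.1, L₁, h₁.1, hne, h₀.2, h₁.2⟩

theorem ncard_klein_not_through {O : Projectivization ℂ (Fin 3 → ℂ)}
    (hO : kleinArrangement.multiplicity O = 4)
    :
    {H | H ∈ kleinArrangement.hyperplanes ∧ ¬ O.submodule ≤ H}.ncard = 17 := by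
  have h := Set.ncard_sdiff (s := {H | H ∈ kleinArrangement.hyperplanes ∧ O.submodule ≤ H})
    (t := kleinArrangement.hyperplanes) (fun _ h => h.1)
    (kleinArrangement.finite.subset fun _ h => h.1)
  have h4 : {H | H ∈ kleinArrangement.hyperplanes ∧ O.submodule ≤ H}.ncard = 4 := hO
  have h21 : kleinArrangement.hyperplanes.ncard = 21 := kleinInt.card_kleinArrangement
  rw [h4, h21] at h
  rw [← (by norm_num : 21 - 4 = 17), ← h]
  congr 1
  ext H
  exact ⟨fun h => ⟨h.1, fun h' => h.2 h'.2⟩, fun h => ⟨h.1, fun h' => h.2 ⟨h.1, h'⟩⟩⟩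

/-- Lines of `B` off `O` are Klein lines, and the joins make `O` modular. Of the `m + 18` lines, 17
miss `O`, leaving `m + 1` through it. -/
theorem klein_extension {O : Projectivization ℂ (Fin 3 → ℂ)}
    (hO : kleinArrangement.multiplicity O = 4)
    {B : HyperplaneArrangement ℂ (Fin 3 → ℂ)}
    (hB : kleinArrangement.hyperplanes ∪ kleinArrangement.joins O ⊆ B.hyperplanes)
    (hBO : ∀ H ∈ B.hyperplanes, H ∉ kleinArrangement.hyperplanes → O.submodule ≤ H) {m : ℕ}
    (hm : B.card = m + 18) : B.IsSupersolvable ∧ B.IsFreeWithExponents ![1, m, 17] := by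
  have hmod : ∀ H₁ ∈ B.hyperplanes, ∀ H₂ ∈ B.hyperplanes, ¬ O.submodule ≤ H₁ →
      ¬ O.submodule ≤ H₂ → H₁ ≠ H₂ → ∃ L ∈ B.hyperplanes, O.submodule ≤ L ∧ H₁ ⊓ H₂ ≤ L := by
    intro H₁ h₁ H₂ h₂ hO₁ hO₂ hne
    have hk₁ : H₁ ∈ kleinArrangement.hyperplanes := by
      by_contra h; exact hO₁ (hBO H₁ h₁ h)
    have hk₂ : H₂ ∈ kleinArrangement.hyperplanes := by
      by_contra h; exact hO₂ (hBO H₂ h₂ h)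
    have hatom := isAtom_inf kleinInt.finrank_eq (B.isCoatom_of_mem h₁) (B.isCoatom_of_mem h₂) hne
    obtain ⟨P, hP⟩ : ∃ P : Projectivization ℂ (Fin 3 → ℂ), P.submodule = H₁ ⊓ H₂ := by
      rw [← isSimpleModule_iff_isAtom, isSimpleModule_iff_finrank_eq_one] at hatom
      exact ⟨_, Projectivization.submodule_mk'' _ hatom⟩
    by_cases hex : ∃ L ∈ kleinArrangement.hyperplanes, O.submodule ≤ L ∧ P.submodule ≤ L
    · obtain ⟨L, hL, hOL, hPL⟩ := hex
      exact ⟨L, hB (Or.inl hL), hOL, hP ▸ hPL⟩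
    · push Not at hex
      refine ⟨O.submodule ⊔ P.submodule, hB (Or.inr ⟨P, ⟨?_, hex⟩, rfl⟩), le_sup_left,
        hP ▸ le_sup_right⟩
      exact (Set.one_lt_ncard (kleinArrangement.finite.subset fun _ h => h.1)).2
        ⟨H₁, ⟨hk₁, hP ▸ inf_le_left⟩, H₂, ⟨hk₂, hP ▸ inf_le_right⟩, hne⟩
  have hn : {H | H ∈ B.hyperplanes ∧ ¬ O.submodule ≤ H}.ncard = 17 := by
    rw [← ncard_klein_not_through hO]
    congr 1
    ext H
    refine and_congr_left fun h => ⟨fun hH => ?_, fun hH => hB (Or.inl hH)⟩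
    by_contra h'
    exact h (hBO H hH h')
  have hthrough : {H | H ∈ B.hyperplanes ∧ O.submodule ≤ H}.ncard = m + 1 := by
    have h := Set.ncard_sdiff (s := {H | H ∈ B.hyperplanes ∧ ¬ O.submodule ≤ H})
      (t := B.hyperplanes) (fun _ h => h.1) (B.finite.subset fun _ h => h.1)
    have hm' : B.hyperplanes.ncard = m + 18 := hm
    rw [hn, hm', show m + 18 - 17 = m + 1 by omega] at h
    rw [← h]
    congr 1
    ext H
    exact ⟨fun h => ⟨h.1, fun h' => h'.2 h.2⟩, fun h => ⟨h.1, by_contra fun h' => h.2 ⟨h.1, h'⟩⟩⟩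
  obtain ⟨L₀, hL₀, L₁, hL₁, hL, hOL₀, hOL₁⟩ := exists_ne_mem_klein hO
  obtain ⟨H₀, hH₀, hOH₀⟩ := Set.nonempty_of_ncard_ne_zero (hn ▸ (by norm_num : 17 ≠ 0))
  refine ⟨B.isSupersolvable_of_modular_point kleinInt.finrank_eq (isAtom_submodule O)
    (hB (Or.inl hL₀)) (hB (Or.inl hL₁)) hL hOL₀ hOL₁ hH₀ hOH₀ hmod, ?_⟩
  simp only [submodule_le_iff] at hmod hn hthrough
  exact isFreeWithExponents_of_modular_point B O.rep_nonzero hmod hthrough hn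

/-- The joins lie in the infinite pencil at `O`, which supplies as many further lines as required.
-/
theorem exists_klein_extension {O : Projectivization ℂ (Fin 3 → ℂ)}
    (hO : kleinArrangement.multiplicity O = 4)
    {c : ℕ} (hc : 33 ≤ c) :
    ∃ B : HyperplaneArrangement ℂ (Fin 3 → ℂ),
      kleinArrangement.hyperplanes ∪ kleinArrangement.joins O ⊆ B.hyperplanes ∧
      (∀ H ∈ B.hyperplanes, H ∉ kleinArrangement.hyperplanes → O.submodule ≤ H) ∧
      B.card = c ∧ (kleinArrangement.hyperplanes ∪ kleinArrangement.joins O).ncard = 33 := by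
  obtain ⟨k, hk, rfl⟩ := kleinInt.exists_eq_singularPoint_of_multiplicity_eq_four hO
  set O := kleinInt.singularPoint k
  have hjoins := kleinInt.ncard_joins hk
  have hfin : (kleinArrangement.joins O).Finite :=
    Set.finite_of_ncard_ne_zero (hjoins ▸ (by norm_num))
  have hdisj : Disjoint kleinArrangement.hyperplanes (kleinArrangement.joins O) := by
    rw [Set.disjoint_left]
    rintro _ hH ⟨P, hP, rfl⟩
    exact hP.2 _ hH le_sup_left le_sup_right
  have h33 : (kleinArrangement.hyperplanes ∪ kleinArrangement.joins O).ncard = 33 := by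
    rw [Set.ncard_union_eq hdisj kleinArrangement.finite hfin, hjoins]
    exact congrArg (· + 12) kleinInt.card_kleinArrangement
  obtain ⟨L₀, hL₀, L₁, hL₁, hL, hOL₀, hOL₁⟩ := exists_ne_mem_klein hO
  have hcoat : ∀ {H}, H ∈ kleinArrangement.hyperplanes → IsCoatom H :=
    kleinArrangement.isCoatom_of_mem
  have hinf := infinite_setOf_isCoatom_inf_le (hcoat hL₀) (hcoat hL₁) hL
  rw [← submodule_eq_inf kleinInt.finrank_eq (hcoat hL₀) (hcoat hL₁) hL hOL₀ hOL₁] at hinf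
  obtain ⟨S, hS, hS', hcard⟩ := (hinf.mono
    (Set.subset_union_right (s := kleinArrangement.hyperplanes))).exists_superset_ncard_eq
    (s := kleinArrangement.hyperplanes ∪ kleinArrangement.joins O)
    (Set.union_subset_union_right _ fun H hH =>
      ⟨isCoatom_of_mem_joins hO hH, le_of_mem_joins hH⟩)
    (kleinArrangement.finite.union hfin) (h33.trans_le hc)
  refine ⟨⟨S, Set.finite_of_ncard_ne_zero (by omega), fun H hH => ?_⟩, hS, fun H hH hK => ?_,
    hcard, h33⟩
  · exact exists_ker_eq_of_isCoatom ((hS' hH).elim hcoat fun h => h.1)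
  · exact ((hS' hH).resolve_left hK).2

theorem exists_klein_resolution {O : Projectivization ℂ (Fin 3 → ℂ)}
    (hO : kleinArrangement.multiplicity O = 4)
    {B : HyperplaneArrangement ℂ (Fin 3 → ℂ)}
    (hB : kleinArrangement.hyperplanes ∪ kleinArrangement.joins O ⊆ B.hyperplanes)
    (hBO : ∀ H ∈ B.hyperplanes, H ∉ kleinArrangement.hyperplanes → O.submodule ≤ H)
    (hcard : B.card = 41) :
    ∃ Y, kleinArrangement.IsSupersolvableResolution 20 Y ∧ Y (Fin.last 20) = B :=
  exists_isSupersolvableResolution (Set.subset_union_left.trans hB)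
    (by rw [hcard, kleinInt.card_kleinArrangement])
    (klein_extension hO hB hBO (m := 23) hcard).1

end HyperplaneArrangement

/-! ### The theorem -/

theorem mainTheorem2 :
    -- the Klein arrangement has 21 lines, 28 triple and 21 quadruple points, no other singularities
    kleinArrangement.card = 21 ∧ kleinArrangement.t 3 = 28 ∧ kleinArrangement.t 4 = 21 ∧
    (∀ P, 2 ≤ kleinArrangement.multiplicity P →
      kleinArrangement.multiplicity P = 3 ∨ kleinArrangement.multiplicity P = 4) ∧
    -- the bound
    kleinArrangement.extSS ≤ 20 ∧
    -- the resolutions, for every quadruple point `O`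
    ∀ O, kleinArrangement.multiplicity O = 4 →
      (kleinArrangement.singOff O).ncard = 20 ∧
      (kleinArrangement.joins O).ncard = 12 ∧
      -- adding exactly the joining lines
      (∃ B : HyperplaneArrangement ℂ (Fin 3 → ℂ),
        B.hyperplanes = kleinArrangement.hyperplanes ∪ kleinArrangement.joins O ∧
        B.card = 33 ∧ B.IsSupersolvable ∧ B.IsFreeWithExponents ![1, 15, 17]) ∧
      -- adding 20 lines through `O`, among them the joining lines: this is possible, and every
      -- choice gives a supersolvable resolution of length 20
      (∃ B : HyperplaneArrangement ℂ (Fin 3 → ℂ),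
        kleinArrangement.hyperplanes ∪ kleinArrangement.joins O ⊆ B.hyperplanes ∧
        (∀ H ∈ B.hyperplanes, H ∉ kleinArrangement.hyperplanes → O.submodule ≤ H) ∧
        B.card = 41) ∧
      (∀ B : HyperplaneArrangement ℂ (Fin 3 → ℂ),
        kleinArrangement.hyperplanes ∪ kleinArrangement.joins O ⊆ B.hyperplanes →
        (∀ H ∈ B.hyperplanes, H ∉ kleinArrangement.hyperplanes → O.submodule ≤ H) →
        B.card = 41 →
        B.IsSupersolvable ∧ B.IsFreeWithExponents ![1, 17, 23] ∧
        ∃ Y, kleinArrangement.IsSupersolvableResolution 20 Y ∧ Y (Fin.last 20) = B) := by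

  refine ⟨kleinInt.card_kleinArrangement, ?_, ?_, fun P hP => ?_, ?_, fun O hO => ?_⟩
  · rw [kleinInt.t_eq (by norm_num)]
    decide +kernel
  · rw [kleinInt.t_eq (by norm_num)]
    decide +kernel
  · obtain ⟨k, rfl⟩ := kleinInt.exists_eq_singularPoint hP
    rw [kleinInt.multiplicity_singularPoint]
    split_ifs <;> simp
  · have hO : kleinArrangement.multiplicity (kleinInt.singularPoint 0) = 4 := by
      rw [kleinInt.multiplicity_singularPoint, if_pos (by decide)]
    obtain ⟨B, hB, hBO, hcard, -⟩ :=
      HyperplaneArrangement.exists_klein_extension hO (c := 41) (by norm_num)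
    obtain ⟨Y, hY, -⟩ := HyperplaneArrangement.exists_klein_resolution hO hB hBO hcard
    exact HyperplaneArrangement.extSS_le hY
  · obtain ⟨k, hk, rfl⟩ := kleinInt.exists_eq_singularPoint_of_multiplicity_eq_four hO
    refine ⟨kleinInt.ncard_singOff hk, kleinInt.ncard_joins hk, ?_, ?_, ?_⟩
    · obtain ⟨B, hB, hBO, hcard, h33⟩ := HyperplaneArrangement.exists_klein_extension hO le_rfl
      -- `B` contains the 33 lines of the union and has only 33, so it is exactly the union.
      have hext := HyperplaneArrangement.klein_extension hO hB hBO (m := 15) hcard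
      exact ⟨B, (Set.eq_of_subset_of_ncard_le hB (by rw [h33]; exact hcard.le) B.finite).symm,
        hcard, hext⟩
    · obtain ⟨B, hB, hBO, hcard, -⟩ :=
      HyperplaneArrangement.exists_klein_extension hO (c := 41) (by norm_num)
      exact ⟨B, hB, hBO, hcard⟩
    · intro B hB hBO hcard
      have hext := HyperplaneArrangement.klein_extension hO hB hBO (m := 23) hcard
      exact ⟨hext.1, hext.2.swap, HyperplaneArrangement.exists_klein_resolution hO hB hBO hcard⟩
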